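/- Let $K\ge 1$ and $\mathcal K_1=\{2,\dots,K\}$. A deterministic many-to-one interference channel has finite alphabets $\mathcal X_i,\mathcal Y_i$ ($1\le i\le K$) and $\mathcal V$. Its outputs are $Y_i=f_i(X_i)$ for $i\in\mathcal K_1$ and $Y_1=f_1(X_1,V)$, where the interference $V=v(X_2,\dots,X_K)\in\mathcal V$ is a function of the inputs of users $2,\dots,K$ and can be recovered from $(Y_1,X_1)$, i.e. $V=f_1^{-1}(Y_1,X_1)$ for some function $f_1^{-1}$. A code of length $T\ge 1$ consists of finite non-empty message sets $\mathcal W_i$, encoders $\phi_i:\mathcal W_i\to\mathcal X_i^T$ and decoders $\psi_i:\mathcal Y_i^T\to\mathcal W_i$ for $1\le i\le K$; its rate is $(R_1,\dots,R_K)$ with $R_i=\frac1T\log_2|\mathcal W_i|$, and its average probability of error is $\Pr(\exists i:\psi_i(Y_i^T)\ne W_i)$ for independent messages $W_i$ uniform on $\mathcal W_i$. A rate tuple is achievable if some sequence of codes, all of that rate and with lengths tending to infinity, has average probability of error tending to $0$; the capacity region $\mathcal C$ is the closure of the set of achievable rate tuples. Let $U_i=g_i(X_i)$, $i\in\mathcal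 K_1$, be finite-valued deterministic functions of the inputs such that $V$ is a deterministic function of $(U_2,\dots,U_K)$. For a product input distribution $p=\prod_{i=1}^K p_{X_i}$ let $\mathcal R(p)$ be the set of all $(R_1,\dots,R_K)$ with $R_i\ge 0$ for all $i$ and $$R_1\le H(Y_1|V),\qquad R_i\le H(Y_i)\quad(i\in\mathcal K_1),$$ $$R_1+\sum_{i\in\mathcal S}R_i\le H(Y_1|U_{\mathcal S^c})+\sum_{i\in\mathcal S}H(Y_i|U_i)\quad\text{for all }\mathcal S\subseteq\mathcal K_1,$$ where $\mathcal S^c=\mathcal K_1\setminus\mathcal S$, $U_{\mathcal S^c}=(U_i)_{i\in\mathcal S^c}$, and entropies are in bits and taken under $p$. Then the convex hull of $\bigcup_p\mathcal R(p)$, over all product input distributions $p$, is achievable, that is, it is contained in the capacity region $\mathcal C$. -/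

import Mathlib

namespace ManyToOne

/-! ### Entropies of random variables on a finite probability space, in bits -/

section Entropy

variable {Ω α β : Type*} [Fintype Ω]

open Classical in
/-- `law q A a` is the probability that `A = a`, when `ω : Ω` has probability `q ω`. -/
noncomputable def law (q : Ω → ℝ) (A : Ω → α) (a : α) : ℝ :=
  ∑ ω with A ω = a, q ω

/-- Shannon entropy `H(A)` in bits. -/
noncomputable def entropy [Fintype α] (q : Ω → ℝ) (A : Ω → α) : ℝ :=
  -∑ a, law q A a * Real.logb 2 (law q A a)

/-- Conditional Shannon entropy `H(A|B)` in bits. -/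
noncomputable def condEntropy [Fintype α] [Fintype β] (q : Ω → ℝ) (A : Ω → α) (B : Ω → β) : ℝ :=
  -∑ b, ∑ a, law q (fun ω => (A ω, B ω)) (a, b) *
    Real.logb 2 (law q (fun ω => (A ω, B ω)) (a, b) / law q B b)

end Entropy

/-- The deterministic many-to-one interference channel with `n + 1` users. User `1` is the index
`0`; the interfering users `2, …, K` are the indices `i.succ` with `i : Fin n`. -/
structure Channel {n : ℕ} (X Y : Fin (n + 1) → Type*) (V : Type*) where
  /-- `Y_i` as a function of `X_i`, for the users other than the first. -/
  out : ∀ i : Fin n, X i.succ → Y i.succ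
  /-- The interference `V` as a function of the inputs other than the first. -/
  interf : (∀ i : Fin n, X i.succ) → V
  /-- `Y_1 = f₁ (X_1, V)`. -/
  f₁ : X 0 → V → Y 0
  /-- `V` can be recovered from `(Y_1, X_1)`. -/
  invertible : ∃ finv : Y 0 → X 0 → V, ∀ x₁ x, finv (f₁ x₁ (interf x)) x₁ = interf x

section Coding

variable {n : ℕ} {X Y : Fin (n + 1) → Type*} {V : Type*}

/-- The value of `V` when the inputs are `x`. -/
def Channel.v (C : Channel X Y V) (x : ∀ i, X i) : V :=
  C.interf fun i => x i.succ

/-- The outputs `(Y_1, …, Y_K)` when the inputs are `x`. -/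
def Channel.y (C : Channel X Y V) (x : ∀ i, X i) : ∀ i, Y i :=
  Fin.cons (C.f₁ (x 0) (C.v x)) fun i => C.out i (x i.succ)

/-- A code: block length `T ≥ 1`, message sets `{0, …, M i - 1}`, encoders and decoders. -/
structure Code {n : ℕ} (X Y : Fin (n + 1) → Type*) where
  T : ℕ
  T_pos : 0 < T
  M : Fin (n + 1) → ℕ
  M_pos : ∀ i, 0 < M i
  enc : ∀ i, Fin (M i) → Fin T → X i
  dec : ∀ i, (Fin T → Y i) → Fin (M i)

/-- The rate tuple of a code, in bits per channel use. -/
noncomputable def Code.rate (c : Code X Y) (i : Fin (n + 1)) : ℝ :=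
  Real.logb 2 (c.M i) / c.T

/-- The decision of receiver `i` when the messages `w` are sent over `T` uses of the channel. -/
def Code.decoded (c : Code X Y) (C : Channel X Y V) (w : ∀ i, Fin (c.M i)) (i : Fin (n + 1)) :
    Fin (c.M i) :=
  c.dec i fun t => C.y (fun j => c.enc j (w j) t) i

open Classical in
/-- The average probability of error: the messages are independent and uniform, and an error
occurs when some receiver does not recover its message. -/
noncomputable def Code.errorProb (c : Code X Y) (C : Channel X Y V) : ℝ :=
  (Finset.univ.filter fun w : ∀ i, Fin (c.M i) => ∃ i, c.decoded C w i ≠ w i).card /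
    ∏ i, (c.M i : ℝ)

/-- `R` is achievable: some sequence of codes with growing block lengths, all of rate `R`, has
vanishing average probability of error. -/
def Channel.Achievable (C : Channel X Y V) (R : Fin (n + 1) → ℝ) : Prop :=
  ∃ c : ℕ → Code X Y, (∀ m, (c m).rate = R) ∧
    Filter.Tendsto (fun m => (c m).T) Filter.atTop Filter.atTop ∧
    Filter.Tendsto (fun m => (c m).errorProb C) Filter.atTop (nhds 0)

/-- The capacity region: the closure of the set of achievable rate tuples. -/
def Channel.capacityRegion (C : Channel X Y V) : Set (Fin (n + 1) → ℝ) :=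
  closure {R | C.Achievable R}

/-- The joint law of independent inputs `X_i` with laws `p i`. -/
def prodLaw (p : ∀ i, X i → ℝ) (x : ∀ i, X i) : ℝ :=
  ∏ i, p i (x i)

/-- The auxiliary variables `U_i = g_i (X_i)`, `i ∉ S`, for a set `S` of interfering users. -/
def auxCompl {U : Fin n → Type*} (g : ∀ i : Fin n, X i.succ → U i) (S : Finset (Fin n))
    (x : ∀ i, X i) (i : {i : Fin n // i ∉ S}) : U i :=
  g i (x i.1.succ)

open Classical in
/-- The rate region for auxiliaries `U_i = g_i (X_i)` and independent inputs with laws `p i`. -/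
noncomputable def Channel.rateRegion [∀ i, Fintype (X i)] [∀ i, Fintype (Y i)] [Fintype V]
    (C : Channel X Y V) {U : Fin n → Type*} [∀ i, Fintype (U i)]
    (g : ∀ i : Fin n, X i.succ → U i) (p : ∀ i, X i → ℝ) : Set (Fin (n + 1) → ℝ) :=
  {R | (∀ i, 0 ≤ R i) ∧
    R 0 ≤ condEntropy (prodLaw p) (fun x => C.y x 0) C.v ∧
    (∀ i : Fin n, R i.succ ≤ entropy (prodLaw p) (fun x => C.y x i.succ)) ∧
    ∀ S : Finset (Fin n), R 0 + ∑ i ∈ S, R i.succ ≤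
      condEntropy (prodLaw p) (fun x => C.y x 0) (auxCompl g S) +
        ∑ i ∈ S, condEntropy (prodLaw p) (fun x => C.y x i.succ) (fun x => g i (x i.succ))}

end Coding

end ManyToOne

/-! The scheme is superposition coding in which receiver 1 decodes only part of the interference.
Each interfering user i splits its message into a cloud index, whose random center has the law of
`U_i`, and a satellite index, whose codeword is drawn given the center. As `V` depends only on the
`U_i`, receiver 1 gets the same output from the codewords as from their cloud centers. It looks for
a codeword of its own and cloud centers of the others that explain its output; every other receiver
looks for any codeword of its own that explains its output.

The channel is deterministic, so a wrong candidate does harm only if it reproduces the received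
sequence exactly. When the wrong and the true candidate are independent with the same law given a
common part B, this happens with the conditional probability of the received output given B
(`prob_collision_le`), which by Chebyshev is about 2^(-T H(Y|B)) or less
(`prob_lt_prod_condProb_le`). A union bound over the set D of users with a wrong index, and an
average over codebooks (`exists_code_errorProb_le`), show that cloud rates rc and satellite rates rp
work if the sum of rc over D is below H(Y_1|U_{D^c}) for every D containing user 1, rc_i + rp_i is
below H(Y_i), and rp_i is below H(Y_i|U_i) (`Channel.achievable_of_lt`).

A point of the region splits explicitly: the satellites carry min(R_i, H(Y_i|U_i)) and the clouds
carry the excess (`exists_isRateSplit`). Convex combinations come from blocks whose slots use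
different input laws: the constraints add over the slots, and the rounding disappears in the closure
(`mem_capacityRegion_of_isRateSplit`). -/

namespace ManyToOne

open Finset

/-! ### Finite weighted probability -/

section Weights

variable {Ω α β γ δ : Type*} [Fintype Ω]

open Classical in
/-- The total weight of the event `E`. -/
noncomputable def prob (q : Ω → ℝ) (E : Ω → Prop) : ℝ :=
  ∑ ω with E ω, q ω

theorem law_eq_prob (q : Ω → ℝ) (A : Ω → α) (a : α) : law q A a = prob q (fun ω => A ω = a) := rfl

open Classical in
theorem prob_eq_sum_ite (q : Ω → ℝ) (E : Ω → Prop) :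
    prob q E = ∑ ω, if E ω then q ω else 0 := by
  rw [prob, Finset.sum_filter]

open Classical in
theorem law_eq_sum_ite (q : Ω → ℝ) (A : Ω → α) (a : α) :
    law q A a = ∑ ω, if A ω = a then q ω else 0 := by
  rw [law, Finset.sum_filter]

theorem prob_nonneg {q : Ω → ℝ} (hq : ∀ ω, 0 ≤ q ω) (E : Ω → Prop) : 0 ≤ prob q E :=
  Finset.sum_nonneg fun ω _ => hq ω

theorem prob_mono {q : Ω → ℝ} (hq : ∀ ω, 0 ≤ q ω) {E F : Ω → Prop}
    (h : ∀ ω, q ω ≠ 0 → E ω → F ω) : prob q E ≤ prob q F := by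
  classical
  rw [prob_eq_sum_ite, prob_eq_sum_ite]
  refine Finset.sum_le_sum fun ω _ => ?_
  by_cases h0 : q ω = 0
  · simp [h0]
  · by_cases hE : E ω
    · simp [hE, h ω h0 hE]
    · simp only [hE, if_false]
      split_ifs
      exacts [hq ω, le_rfl]

theorem prob_congr {q : Ω → ℝ} {E F : Ω → Prop} (h : ∀ ω, q ω ≠ 0 → (E ω ↔ F ω)) :
    prob q E = prob q F := by
  classical
  rw [prob_eq_sum_ite, prob_eq_sum_ite]
  refine Finset.sum_congr rfl fun ω _ => ?_
  by_cases h0 : q ω = 0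
  · simp [h0]
  · simp [h ω h0]

theorem prob_or_le {q : Ω → ℝ} (hq : ∀ ω, 0 ≤ q ω) (E F : Ω → Prop) :
    prob q (fun ω => E ω ∨ F ω) ≤ prob q E + prob q F := by
  classical
  simp only [prob_eq_sum_ite, ← Finset.sum_add_distrib]
  refine Finset.sum_le_sum fun ω _ => ?_
  have := hq ω
  by_cases hE : E ω <;> by_cases hF : F ω <;> simp [hE, hF, this]

theorem prob_exists_le {J : Type*} {q : Ω → ℝ} (hq : ∀ ω, 0 ≤ q ω) (s : Finset J)
    (E : J → Ω → Prop) :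
    prob q (fun ω => ∃ j ∈ s, E j ω) ≤ ∑ j ∈ s, prob q (E j) := by
  classical
  simp only [prob_eq_sum_ite]
  rw [Finset.sum_comm]
  refine Finset.sum_le_sum fun ω _ => ?_
  have hn : ∀ j ∈ s, 0 ≤ (if E j ω then q ω else 0) := fun j _ => by
    split_ifs
    exacts [hq ω, le_rfl]
  by_cases h : ∃ j ∈ s, E j ω
  · rw [if_pos h]
    obtain ⟨j, hj, hE⟩ := h
    have := Finset.single_le_sum hn hj
    rwa [if_pos hE] at this
  · rw [if_neg h]
    exact Finset.sum_nonneg hn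

theorem sum_law_mul [Fintype α] (q : Ω → ℝ) (A : Ω → α) (ψ : α → ℝ) :
    ∑ a, law q A a * ψ a = ∑ ω, q ω * ψ (A ω) := by
  classical
  simp only [law_eq_sum_ite, Finset.sum_mul]
  rw [Finset.sum_comm]
  refine Finset.sum_congr rfl fun ω _ => ?_
  simp [ite_mul]

theorem sum_law [Fintype α] (q : Ω → ℝ) (A : Ω → α) : ∑ a, law q A a = ∑ ω, q ω := by
  simpa using sum_law_mul q A fun _ => 1

theorem prob_law [Fintype α] (q : Ω → ℝ) (A : Ω → α) (E : α → Prop) :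
    prob (law q A) E = prob q (fun ω => E (A ω)) := by
  classical
  simpa [prob_eq_sum_ite] using sum_law_mul q A fun a => if E a then 1 else 0

theorem law_law [Fintype α] (q : Ω → ℝ) (A : Ω → α) (r : α → β) :
    law (law q A) r = law q (fun ω => r (A ω)) := by
  funext b
  exact prob_law q A fun a => r a = b

theorem law_nonneg {q : Ω → ℝ} (hq : ∀ ω, 0 ≤ q ω) (A : Ω → α) (a : α) : 0 ≤ law q A a :=
  prob_nonneg hq _

theorem le_law {q : Ω → ℝ} (hq : ∀ ω, 0 ≤ q ω) (A : Ω → α) (ω : Ω) : q ω ≤ law q A (A ω) :=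
  Finset.single_le_sum (f := q) (fun ω _ => hq ω) (by simp)

theorem law_pos {q : Ω → ℝ} (hq : ∀ ω, 0 ≤ q ω) (A : Ω → α) {ω : Ω} (h : q ω ≠ 0) :
    0 < law q A (A ω) :=
  ((hq ω).lt_of_ne' h).trans_le (le_law hq A ω)

theorem law_equiv (q : Ω → ℝ) (e : Ω ≃ α) (a : α) : law q e a = q (e.symm a) := by
  classical
  rw [law_eq_sum_ite, Finset.sum_eq_single (e.symm a)]
  · simp
  · intro ω _ h
    rw [if_neg]
    rintro rfl
    simp at h
  · simp

/-- The conditional probability of the value of `A` at `ω` given the value of `B` at `ω`. -/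
noncomputable def condProb (q : Ω → ℝ) (A : Ω → α) (B : Ω → β) (ω : Ω) : ℝ :=
  law q (fun ω => (A ω, B ω)) (A ω, B ω) / law q B (B ω)

theorem condProb_nonneg {q : Ω → ℝ} (hq : ∀ ω, 0 ≤ q ω) (A : Ω → α) (B : Ω → β) (ω : Ω) :
    0 ≤ condProb q A B ω :=
  div_nonneg (law_nonneg hq _ _) (law_nonneg hq _ _)

theorem condProb_pos {q : Ω → ℝ} (hq : ∀ ω, 0 ≤ q ω) (A : Ω → α) (B : Ω → β) {ω : Ω}
    (h : q ω ≠ 0) : 0 < condProb q A B ω :=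
  div_pos (law_pos hq (fun ω => (A ω, B ω)) h) (law_pos hq B h)

theorem condProb_comp [Fintype γ] (q : Ω → ℝ) (φ : Ω → γ) (A : γ → α) (B : γ → β) (ω : Ω) :
    condProb q (fun ω => A (φ ω)) (fun ω => B (φ ω)) ω = condProb (law q φ) A B (φ ω) := by
  simp only [condProb, law_law]

/-- Only the partitions induced by the variables matter. This permits replacing auxiliaries by fiber
representatives and transposing tuples. -/
theorem condProb_congr (q : Ω → ℝ) {A : Ω → α} {A' : Ω → γ} {B : Ω → β} {B' : Ω → δ}
    (hA : ∀ ω ω', A ω = A ω' ↔ A' ω = A' ω') (hB : ∀ ω ω', B ω = B ω' ↔ B' ω = B' ω') :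
    condProb q A B = condProb q A' B' := by
  funext ω
  simp only [condProb, law_eq_prob, Prod.mk.injEq, hA, hB]

/-- Conditional entropy as the expected information density. -/
theorem condEntropy_eq_sum [Fintype α] [Fintype β] (q : Ω → ℝ) (A : Ω → α) (B : Ω → β) :
    condEntropy q A B = -∑ ω, q ω * Real.logb 2 (condProb q A B ω) := by
  rw [condEntropy, Finset.sum_comm, ← Fintype.sum_prod_type']
  exact congrArg Neg.neg (sum_law_mul q (fun ω => (A ω, B ω)) fun x =>
    Real.logb 2 (law q (fun ω => (A ω, B ω)) x / law q B x.2))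

theorem condProb_unit {q : Ω → ℝ} (hq : ∑ ω, q ω = 1) (A : Ω → α) (ω : Ω) :
    condProb q A (fun _ => ()) ω = law q A (A ω) := by
  have h : law q (fun _ => ()) () = 1 := by simp [law_eq_sum_ite, hq]
  rw [condProb, h, div_one]
  exact prob_congr fun ω _ => by simp

theorem entropy_eq_sum [Fintype α] {q : Ω → ℝ} (hq : ∑ ω, q ω = 1) (A : Ω → α) :
    entropy q A = -∑ ω, q ω * Real.logb 2 (condProb q A (fun _ => ()) ω) := by
  simp only [condProb_unit hq]
  rw [entropy, sum_law_mul q A fun a => Real.logb 2 (law q A a)]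

end Weights

/-! ### Product weights -/

section Product

variable {K J : Type*} [Fintype K] {Z : K → Type*}

/-- The product of the weights `w k`. -/
def piLaw (w : ∀ k, Z k → ℝ) (ω : ∀ k, Z k) : ℝ :=
  ∏ k, w k (ω k)

theorem piLaw_nonneg {w : ∀ k, Z k → ℝ} (hw : ∀ k z, 0 ≤ w k z) (ω : ∀ k, Z k) :
    0 ≤ piLaw w ω :=
  Finset.prod_nonneg fun k _ => hw k _

theorem piLaw_ne_zero {w : ∀ k, Z k → ℝ} {ω : ∀ k, Z k} (h : piLaw w ω ≠ 0) (k : K) :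
    w k (ω k) ≠ 0 :=
  Finset.prod_ne_zero_iff.1 h k (Finset.mem_univ k)

variable [DecidableEq K] [∀ k, Fintype (Z k)]

theorem sum_piLaw_mul_prod (w f : ∀ k, Z k → ℝ) :
    ∑ ω, piLaw w ω * ∏ k, f k (ω k) = ∏ k, ∑ z, w k z * f k z := by
  classical
  simp only [piLaw, ← Finset.prod_mul_distrib]
  rw [Finset.prod_univ_sum, Fintype.piFinset_univ]

theorem sum_piLaw {w : ∀ k, Z k → ℝ} (hw : ∀ k, ∑ z, w k z = 1) : ∑ ω, piLaw w ω = 1 := by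
  simpa [hw] using sum_piLaw_mul_prod w fun _ _ => 1

/-- Functions of distinct coordinates of a product are independent. -/
theorem law_piLaw_comp [Fintype J] {W : J → Type*} {w : ∀ k, Z k → ℝ}
    (hw : ∀ k, ∑ z, w k z = 1) {e : J → K} (he : Function.Injective e)
    (r : ∀ j, Z (e j) → W j) (v : ∀ j, W j) :
    law (piLaw w) (fun ω j => r j (ω (e j))) v = ∏ j, law (w (e j)) (r j) (v j) := by
  classical
  -- Coordinates outside the range of `e` impose an empty condition, so their factor is 1. The
  -- transport along `h` allows a definition at every `k`.
  let f : ∀ k, Z k → ℝ := fun k z => if ∀ j (h : e j = k), r j (h ▸ z) = v j then 1 else 0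
  have key := sum_piLaw_mul_prod w f
  have hl : law (piLaw w) (fun ω j => r j (ω (e j))) v = ∑ ω, piLaw w ω * ∏ k, f k (ω k) := by
    rw [law_eq_sum_ite]
    refine Finset.sum_congr rfl fun ω _ => ?_
    have : (∏ k, f k (ω k)) = if (fun j => r j (ω (e j))) = v then 1 else 0 := by
      simp only [f]
      rw [Finset.prod_ite_zero]
      simp only [Finset.mem_univ, true_implies, Finset.prod_const_one]
      congr 1
      rw [funext_iff, eq_iff_iff]
      constructor
      · intro h j
        exact h (e j) j rfl
      · rintro h k j rfl
        exact h j
    rw [this]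
    split_ifs <;> simp
  rw [hl, key]
  have hr : ∏ k, ∑ z, w k z * f k z = ∏ k ∈ Finset.univ.image e, ∑ z, w k z * f k z := by
    symm
    refine Finset.prod_subset (Finset.subset_univ _) fun k _ hk => ?_
    rw [← hw k]
    refine Finset.sum_congr rfl fun z _ => ?_
    have : f k z = 1 := by
      simp only [f]
      rw [if_pos]
      intro j h
      exact absurd (Finset.mem_image.2 ⟨j, Finset.mem_univ j, h⟩) hk
    rw [this, mul_one]
  rw [hr, Finset.prod_image fun a _ b _ h => he h]
  refine Finset.prod_congr rfl fun j _ => ?_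
  rw [law_eq_sum_ite]
  refine Finset.sum_congr rfl fun z _ => ?_
  have : f (e j) z = if r j z = v j then 1 else 0 := by
    simp only [f]
    congr 1
    rw [eq_iff_iff]
    constructor
    · intro h
      exact h j rfl
    · intro h j' hj'
      obtain rfl := he hj'
      exact h
  rw [this]
  split_ifs <;> simp

/-- The law of a single coordinate of a product. -/
theorem law_piLaw_eval {γ : Type*} {w : ∀ k, Z k → ℝ} (hw : ∀ k, ∑ z, w k z = 1) (k : K)
    (r : Z k → γ) : law (piLaw w) (fun ω => r (ω k)) = law (w k) r := by
  funext c
  have := law_piLaw_comp hw (e := fun _ : Unit => k) (fun _ _ _ => rfl) (fun _ => r) fun _ => c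
  simpa [law_eq_prob, funext_iff] using this

theorem law_id {Ω : Type*} [Fintype Ω] (q : Ω → ℝ) : law q (fun ω => ω) = q := by
  funext ω
  exact law_equiv q (Equiv.refl Ω) ω

/-- The conditional probabilities of a product of independent pairs multiply. -/
theorem condProb_piLaw {α β : K → Type*} {w : ∀ k, Z k → ℝ} (hw : ∀ k, ∑ z, w k z = 1)
    (A : ∀ k, Z k → α k) (B : ∀ k, Z k → β k) (ω : ∀ k, Z k) :
    condProb (piLaw w) (fun ω k => A k (ω k)) (fun ω k => B k (ω k)) ω =
      ∏ k, condProb (w k) (A k) (B k) (ω k) := by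
  have h1 := law_piLaw_comp hw (e := id) Function.injective_id B fun k => B k (ω k)
  have h2 := law_piLaw_comp hw (e := id) Function.injective_id (fun k z => (A k z, B k z))
    fun k => (A k (ω k), B k (ω k))
  simp only [id] at h1 h2
  simp only [condProb, Finset.prod_div_distrib, ← h1, ← h2]
  congr 1
  simp only [law_eq_prob, Prod.mk.injEq, funext_iff, forall_and]

end Product

/-! ### Collisions of conditionally independent variables -/

section Collision

theorem law_semidirect {α β γ : Type*} [Fintype α] [Fintype β] (μ : β → ℝ) (ν : β → α → ℝ)
    (r : α → γ) (b : β) (c : γ) :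
    law (fun t : β × α => μ t.1 * ν t.1 t.2) (fun t => (t.1, r t.2)) (b, c) =
      μ b * law (ν b) r c := by
  classical
  simp only [law_eq_sum_ite, Fintype.sum_prod_type, Prod.mk.injEq, Finset.mul_sum]
  rw [Finset.sum_eq_single b]
  · simp
  · intro b' _ h
    simp [h]
  · simp

theorem condProb_semidirect {α β Y : Type*} [Fintype α] [Fintype β] {μ : β → ℝ}
    {ν : β → α → ℝ} (hν1 : ∀ b, μ b ≠ 0 → ∑ a, ν b a = 1) (F : β → α → Y) {b : β} (hb : μ b ≠ 0)
    (a : α) :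
    condProb (fun s : β × α => μ s.1 * ν s.1 s.2) (fun s => F s.1 s.2) Prod.fst (b, a) =
      law (ν b) (F b) (F b a) := by
  have h1 := law_semidirect μ ν (F b) b (F b a)
  have h2 := law_semidirect μ ν (fun _ => ()) b ()
  have h3 : law (ν b) (fun _ => ()) () = 1 := by
    simp [law_eq_sum_ite, hν1 b hb]
  rw [h3, mul_one] at h2
  rw [condProb, ← mul_div_cancel_left₀ (law (ν b) (F b) (F b a)) hb, ← h1]
  congr 1
  · refine prob_congr fun t _ => ?_
    simp only [Prod.mk.injEq]
    constructor
    · rintro ⟨h, rfl⟩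
      exact ⟨rfl, h⟩
    · rintro ⟨rfl, h⟩
      exact ⟨h, rfl⟩
  · rw [← h2]
    exact prob_congr fun t _ => by simp

/-- Given `b` and `a`, an independent copy `a'` hits the value `F b a` with exactly the conditional
probability of that value. The event itself caps this number by `θ`, and averaging over `b` and `a`
keeps the bound. -/
theorem prob_collision_semidirect_le {α β Y : Type*} [Fintype α] [Fintype β] {μ : β → ℝ}
    {ν : β → α → ℝ} (hμ : ∀ b, 0 ≤ μ b) (hν : ∀ b a, 0 ≤ ν b a) (hμ1 : ∑ b, μ b = 1)
    (hν1 : ∀ b, μ b ≠ 0 → ∑ a, ν b a = 1) (F : β → α → Y) {θ : ℝ} (hθ : 0 ≤ θ) :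
    prob (fun t : β × α × α => μ t.1 * ν t.1 t.2.1 * ν t.1 t.2.2)
      (fun t => F t.1 t.2.2 = F t.1 t.2.1 ∧
        condProb (fun s : β × α => μ s.1 * ν s.1 s.2) (fun s => F s.1 s.2) Prod.fst (t.1, t.2.1)
          ≤ θ) ≤ θ := by
  classical
  rw [prob_eq_sum_ite, Fintype.sum_prod_type]
  calc _ ≤ ∑ b, μ b * θ := ?_
    _ = θ := by rw [← Finset.sum_mul, hμ1, one_mul]
  refine Finset.sum_le_sum fun b _ => ?_
  by_cases hb : μ b = 0
  · simp [hb]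
  rw [Fintype.sum_prod_type]
  calc _ ≤ ∑ a, μ b * (ν b a * θ) := ?_
    _ = μ b * θ := by rw [← Finset.mul_sum, ← Finset.sum_mul, hν1 b hb, one_mul]
  refine Finset.sum_le_sum fun a _ => ?_
  simp only [condProb_semidirect hν1 F hb a]
  have hn := mul_nonneg (hμ b) (hν b a)
  by_cases hg : law (ν b) (F b) (F b a) ≤ θ
  · rw [← mul_assoc]
    refine le_trans (le_of_eq ?_) (mul_le_mul_of_nonneg_left hg hn)
    simp only [hg, and_true]
    rw [law_eq_sum_ite, Finset.mul_sum]
    refine Finset.sum_congr rfl fun a' _ => ?_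
    by_cases h : F b a' = F b a <;> simp [h]
  · simp only [hg, and_false, if_false, Finset.sum_const_zero]
    exact mul_nonneg (hμ b) (mul_nonneg (hν b a) hθ)

/-- If, given `b`, the variables `a` and `a'` are independent with the same law, then `F b a'`
collides with a value of `F b a` of conditional probability at most `θ` with probability at
most `θ`. -/
theorem prob_collision_le {Ω Ω' α β Y : Type*} [Fintype Ω] [Fintype Ω'] [Fintype α] [Fintype β]
    {μ : β → ℝ} {ν : β → α → ℝ} (hμ : ∀ b, 0 ≤ μ b) (hν : ∀ b a, 0 ≤ ν b a)
    (hμ1 : ∑ b, μ b = 1) (hν1 : ∀ b, μ b ≠ 0 → ∑ a, ν b a = 1) (F : β → α → Y)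
    {q : Ω → ℝ} {φ : Ω → β × α} (hφ : ∀ b a, law q φ (b, a) = μ b * ν b a)
    {q' : Ω' → ℝ} (hq' : ∀ ω, 0 ≤ q' ω) {τ : Ω' → β × α × α}
    (hτ : ∀ b a a', law q' τ (b, a, a') = μ b * ν b a * ν b a')
    {x : Ω' → Ω} (hx : ∀ ω, q' ω ≠ 0 → φ (x ω) = ((τ ω).1, (τ ω).2.1))
    {θ : ℝ} (hθ : 0 ≤ θ) {E : Ω' → Prop}
    (hE : ∀ ω, q' ω ≠ 0 → E ω → F (τ ω).1 (τ ω).2.2 = F (τ ω).1 (τ ω).2.1) :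
    prob q' (fun ω => E ω ∧
      condProb q (fun ω => F (φ ω).1 (φ ω).2) (fun ω => (φ ω).1) (x ω) ≤ θ) ≤ θ := by
  have h1 : law q φ = fun s => μ s.1 * ν s.1 s.2 := funext fun s => hφ s.1 s.2
  have h2 : law q' τ = fun t => μ t.1 * ν t.1 t.2.1 * ν t.1 t.2.2 :=
    funext fun t => hτ t.1 t.2.1 t.2.2
  have key := prob_collision_semidirect_le hμ hν hμ1 hν1 F hθ
  rw [← h1, ← h2, prob_law] at key
  refine (prob_mono hq' ?_).trans key
  rintro ω hω ⟨he, hc⟩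
  refine ⟨hE ω hω he, ?_⟩
  rw [condProb_comp q φ (fun s => F s.1 s.2) Prod.fst, hx ω hω] at hc
  exact hc

end Collision

/-! ### Superposition codebooks -/

section Block

variable {X N J : Type*} [Fintype X] [Fintype N]

open Classical in
/-- The conditional law of `x` given `g x = u`. -/
noncomputable def fiberLaw (P : X → ℝ) (g : X → X) (u x : X) : ℝ :=
  if g x = u then P x / law P g u else 0

/-- The law of a cloud center `u` with the law of `g x`, and of satellites that are independent
given `u`, with the conditional law of `x` given `g x = u`. -/
noncomputable def blockLaw (P : X → ℝ) (g : X → X) (b : X × (N → X)) : ℝ :=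
  law P g b.1 * piLaw (fun _ => fiberLaw P g b.1) b.2

variable {P : X → ℝ} {g : X → X}

theorem fiberLaw_nonneg (hP : ∀ x, 0 ≤ P x) (u x : X) : 0 ≤ fiberLaw P g u x := by
  rw [fiberLaw]
  split_ifs
  exacts [div_nonneg (hP x) (law_nonneg hP _ _), le_rfl]

theorem sum_fiberLaw {u : X} (hu : law P g u ≠ 0) : ∑ x, fiberLaw P g u x = 1 := by
  classical
  simp only [fiberLaw]
  rw [← Finset.sum_filter, ← Finset.sum_div]
  exact div_self hu

theorem law_mul_fiberLaw (hP : ∀ x, 0 ≤ P x) (u x : X) :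
    law P g u * fiberLaw P g u x = law P (fun x => (g x, x)) (u, x) := by
  classical
  have h : law P (fun x => (g x, x)) (u, x) = if g x = u then P x else 0 := by
    rw [law_eq_sum_ite, Finset.sum_eq_single x]
    · simp
    · intro y _ hy
      simp [hy]
    · simp
  rw [h, fiberLaw]
  split_ifs with hg
  · by_cases h0 : law P g u = 0
    · have := le_law hP g x
      rw [hg, h0] at this
      rw [h0, le_antisymm this (hP x), zero_mul]
    · exact mul_div_cancel₀ _ h0
  · exact mul_zero _

theorem blockLaw_nonneg (hP : ∀ x, 0 ≤ P x) (b : X × (N → X)) : 0 ≤ blockLaw P g b :=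
  mul_nonneg (law_nonneg hP _ _) (piLaw_nonneg (fun _ => fiberLaw_nonneg hP _) _)

theorem eq_of_blockLaw_ne_zero {b : X × (N → X)} (hb : blockLaw P g b ≠ 0) (s : N) :
    g (b.2 s) = b.1 := by
  have h := piLaw_ne_zero (right_ne_zero_of_mul hb) s
  by_contra hne
  exact h (by simp [fiberLaw, hne])

variable [DecidableEq N]

theorem law_blockLaw_comp [Fintype J] {e : J → N} (he : Function.Injective e) (u : X)
    (v : J → X) :
    law (blockLaw P g) (fun b : X × (N → X) => (b.1, fun j => b.2 (e j))) (u, v) =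
      law P g u * ∏ j, fiberLaw P g u (v j) := by
  classical
  have h := law_semidirect (law P g) (fun u => piLaw fun _ : N => fiberLaw P g u)
    (fun x j => x (e j)) u v
  refine h.trans ?_
  -- A center of probability zero has no conditional law, so independence is unavailable there, but
  -- both sides vanish.
  by_cases hu : law P g u = 0
  · simp [hu]
  · rw [law_piLaw_comp (fun _ => sum_fiberLaw hu) he (fun _ x => x) v]
    simp only [law_id]

theorem law_blockLaw_fst :
    law (blockLaw P g) (fun b : X × (N → X) => b.1) = law P g := by
  funext u
  -- Selecting no satellite leaves the cloud center alone.
  have h := law_blockLaw_comp (P := P) (g := g) (N := N) (e := (Empty.elim : Empty → N))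
    (fun x => x.elim) u (fun x => x.elim)
  simp only [Finset.univ_eq_empty, Finset.prod_empty, mul_one] at h
  rw [← h]
  refine prob_congr fun b _ => ?_
  simp [Prod.ext_iff, funext_iff]

theorem sum_blockLaw (hP1 : ∑ x, P x = 1) : ∑ b : X × (N → X), blockLaw P g b = 1 := by
  classical
  rw [← sum_law _ (fun b : X × (N → X) => b.1), law_blockLaw_fst, sum_law, hP1]

theorem law_blockLaw_satellite (hP : ∀ x, 0 ≤ P x) (s : N) :
    law (blockLaw P g) (fun b : X × (N → X) => b.2 s) = P := by
  have h : law (blockLaw P g) (fun b : X × (N → X) => (b.1, b.2 s)) =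
      law P (fun x => (g x, x)) := by
    funext t
    rw [← law_mul_fiberLaw hP]
    have h := law_blockLaw_comp (P := P) (g := g) (e := fun _ : Unit => s)
      (fun _ _ _ => rfl) t.1 (fun _ => t.2)
    simp only [Finset.univ_unique, Finset.prod_singleton] at h
    rw [← h]
    refine prob_congr fun b _ => ?_
    simp [Prod.ext_iff, funext_iff]
  have h2 := congrArg (fun q => law q Prod.snd) h
  simpa only [law_law, law_id] using h2

theorem law_blockLaw_satellites {s s' : N} (hs : s ≠ s') (u x x' : X) :
    law (blockLaw P g) (fun b : X × (N → X) => (b.1, b.2 s, b.2 s')) (u, x, x') =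
      law P g u * fiberLaw P g u x * fiberLaw P g u x' := by
  have h := law_blockLaw_comp (P := P) (g := g) (e := fun j : Bool => bif j then s else s')
    (by
      rintro (_ | _) (_ | _) h
      exacts [rfl, absurd h.symm hs, absurd h hs, rfl]) u (fun j => bif j then x else x')
  simp only [Fintype.prod_bool, cond_true, cond_false] at h
  rw [mul_assoc, ← h]
  refine prob_congr fun b _ => ?_
  simp [Prod.ext_iff, funext_iff, and_comm]

end Block

/-! ### Random codebooks and their collision probabilities -/

section Codebook

variable {ι : Type*} {X C N : ι → Type*}

/-- A superposition codebook: for each user `i` and cloud index in `C i`, a cloud center and a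
satellite codeword for each index in `N i`. -/
abbrev Codebook (X C N : ι → Type*) : Type _ :=
  ∀ k : Σ i, C i, X k.1 × (N k.1 → X k.1)

/-- The codeword of user `i` for the message `w`. -/
def Codebook.word (ω : Codebook X C N) (i : ι) (w : C i × N i) : X i :=
  (ω ⟨i, w.1⟩).2 w.2

/-- The cloud center of user `i` with index `c`. -/
def Codebook.cloud (ω : Codebook X C N) (i : ι) (c : C i) : X i :=
  (ω ⟨i, c⟩).1

/-- Combines a tuple indexed by `D` with a tuple indexed by the complement of `D`. -/
def merge [DecidableEq ι] (D : Finset ι) (b : ∀ i : {i // i ∉ D}, X i) (a : ∀ i : {i // i ∈ D}, X i) (i : ι) :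
    X i :=
  if h : i ∈ D then a ⟨i, h⟩ else b ⟨i, h⟩

theorem merge_restrict [DecidableEq ι] (D : Finset ι) (x y : ∀ i, X i) (h : ∀ i, i ∉ D → x i = y i) :
    merge D (fun i => x i.1) (fun i => y i.1) = y := by
  funext i
  by_cases hi : i ∈ D <;> simp [merge, hi, h]

variable [Fintype ι] [∀ i, Fintype (X i)] [∀ i, Fintype (C i)] [∀ i, Fintype (N i)]
  {P : ∀ i, X i → ℝ} {g : ∀ i, X i → X i}

/-- The law of a random codebook with independent clouds. -/
noncomputable def bookLaw (P : ∀ i, X i → ℝ) (g : ∀ i, X i → X i) :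
    Codebook X C N → ℝ :=
  piLaw fun k => blockLaw (P k.1) (g k.1)

theorem bookLaw_nonneg (hP : ∀ i x, 0 ≤ P i x) (ω : Codebook X C N) : 0 ≤ bookLaw P g ω :=
  piLaw_nonneg (fun k => blockLaw_nonneg (hP k.1)) ω

/-- `fiberLaw` vanishes off the fiber. This is what lets receiver 1 reason with cloud centers in
place of codewords. -/
theorem Codebook.map_word {ω : Codebook X C N} (hω : bookLaw P g ω ≠ 0) (i : ι)
    (w : C i × N i) : g i (ω.word i w) = ω.cloud i w.1 :=
  eq_of_blockLaw_ne_zero (piLaw_ne_zero hω ⟨i, w.1⟩) w.2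

variable [DecidableEq ι] [∀ i, DecidableEq (C i)] [∀ i, DecidableEq (N i)]

theorem sum_bookLaw (hP1 : ∀ i, ∑ x, P i x = 1) :
    ∑ ω : Codebook X C N, bookLaw P g ω = 1 :=
  sum_piLaw fun k => sum_blockLaw (hP1 k.1)

theorem law_bookLaw_words (hP : ∀ i x, 0 ≤ P i x) (hP1 : ∀ i, ∑ x, P i x = 1)
    (w : ∀ i, C i × N i) :
    law (bookLaw P g) (fun ω : Codebook X C N => fun i => ω.word i (w i)) = piLaw P := by
  funext x
  have h := law_piLaw_comp (w := fun k : Σ i, C i => blockLaw (N := N k.1) (P k.1) (g k.1))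
    (fun k => sum_blockLaw (hP1 k.1)) (e := fun i => (⟨i, (w i).1⟩ : Σ i, C i))
    (fun i j h => congrArg Sigma.fst h) (fun i b => b.2 (w i).2) x
  refine h.trans ?_
  simp only [law_blockLaw_satellite (hP _)]
  rfl

theorem law_bookLaw_word (hP : ∀ i x, 0 ≤ P i x) (hP1 : ∀ i, ∑ x, P i x = 1) (i : ι)
    (w : C i × N i) :
    law (bookLaw P g) (fun ω : Codebook X C N => ω.word i w) = P i := by
  have h := law_piLaw_eval (w := fun k : Σ i, C i => blockLaw (N := N k.1) (P k.1) (g k.1))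
    (fun k => sum_blockLaw (hP1 k.1)) ⟨i, w.1⟩ fun b => b.2 w.2
  exact h.trans (law_blockLaw_satellite (hP i) w.2)

/-- Different cloud indices of one user belong to different, independent blocks. Within one cloud,
independence holds only given the center. -/
theorem law_bookLaw_words_of_ne (hP : ∀ i x, 0 ≤ P i x) (hP1 : ∀ i, ∑ x, P i x = 1) (i : ι)
    {w w' : C i × N i} (hw : w.1 ≠ w'.1) (x x' : X i) :
    law (bookLaw P g) (fun ω : Codebook X C N => (ω.word i w, ω.word i w')) (x, x') =
      P i x * P i x' := by
  have h := law_piLaw_comp (w := fun k : Σ i, C i => blockLaw (N := N k.1) (P k.1) (g k.1))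
    (fun k => sum_blockLaw (hP1 k.1))
    (e := fun j : Bool => (⟨i, bif j then w.1 else w'.1⟩ : Σ i, C i))
    (by
      rintro (_ | _) (_ | _) h
      · rfl
      · simp at h
        exact absurd h.symm hw
      · simp at h
        exact absurd h hw
      · rfl)
    (fun j b => b.2 (bif j then w.2 else w'.2)) (fun j => bif j then x else x')
  simp only [Fintype.prod_bool, cond_true, cond_false, law_blockLaw_satellite (hP _)] at h
  rw [← h]
  refine prob_congr fun b _ => ?_
  simp [Codebook.word, Prod.ext_iff, funext_iff, and_comm]

theorem law_bookLaw_satellites (hP1 : ∀ i, ∑ x, P i x = 1) (i : ι) (c : C i) {s s' : N i}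
    (hs : s ≠ s') (u x x' : X i) :
    law (bookLaw P g)
      (fun ω : Codebook X C N => (ω.cloud i c, ω.word i (c, s), ω.word i (c, s'))) (u, x, x') =
      law (P i) (g i) u * fiberLaw (P i) (g i) u x * fiberLaw (P i) (g i) u x' := by
  have h := law_piLaw_eval (w := fun k : Σ i, C i => blockLaw (N := N k.1) (P k.1) (g k.1))
    (fun k => sum_blockLaw (hP1 k.1)) ⟨i, c⟩ fun b => (b.1, b.2 s, b.2 s')
  exact (congrFun h (u, x, x')).trans (law_blockLaw_satellites hs u x x')

theorem law_piLaw_split (hP1 : ∀ i, ∑ x, P i x = 1) (D : Finset ι)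
    (b : ∀ i : {i // i ∉ D}, X i) (a : ∀ i : {i // i ∈ D}, X i) :
    law (piLaw P) (fun x => ((fun i : {i // i ∉ D} => g i (x i)),
      (fun i : {i // i ∈ D} => g i (x i)))) (b, a) =
      piLaw (fun i : {i // i ∉ D} => law (P i) (g i)) b *
        piLaw (fun i : {i // i ∈ D} => law (P i) (g i)) a := by
  have h := law_piLaw_comp hP1
    (e := Sum.elim (fun i : {i // i ∉ D} => i.1) (fun i : {i // i ∈ D} => i.1))
    (by
      rintro (i | i) (j | j) h
      · exact congrArg Sum.inl (Subtype.ext h)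
      · exact absurd ((show i.1 = j.1 from h) ▸ j.2) i.2
      · exact absurd ((show i.1 = j.1 from h) ▸ i.2) j.2
      · exact congrArg Sum.inr (Subtype.ext h))
    (fun j => g _) (fun j => match j with | .inl i => b i | .inr i => a i)
  rw [Fintype.prod_sum_type] at h
  refine Eq.trans ?_ h
  refine prob_congr fun x _ => ?_
  simp [Prod.ext_iff, funext_iff]

/-- The shared centers outside `D`, the true centers in `D` and the wrong ones in `D` sit in
pairwise distinct blocks, because `c'` differs from `c` throughout `D`. -/
theorem law_bookLaw_clouds (hP1 : ∀ i, ∑ x, P i x = 1) (D : Finset ι) (c c' : ∀ i, C i)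
    (hc : ∀ i ∈ D, c' i ≠ c i) (b : ∀ i : {i // i ∉ D}, X i) (a a' : ∀ i : {i // i ∈ D}, X i) :
    law (bookLaw P g) (fun ω : Codebook X C N =>
      ((fun i : {i // i ∉ D} => ω.cloud i (c i)), (fun i : {i // i ∈ D} => ω.cloud i (c i)),
        (fun i : {i // i ∈ D} => ω.cloud i (c' i)))) (b, a, a') =
      piLaw (fun i : {i // i ∉ D} => law (P i) (g i)) b *
        piLaw (fun i : {i // i ∈ D} => law (P i) (g i)) a *
        piLaw (fun i : {i // i ∈ D} => law (P i) (g i)) a' := by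
  have h := law_piLaw_comp (w := fun k : Σ i, C i => blockLaw (N := N k.1) (P k.1) (g k.1))
    (fun k => sum_blockLaw (hP1 k.1))
    (e := Sum.elim (fun i : {i // i ∉ D} => (⟨i.1, c i.1⟩ : Σ i, C i))
      (Sum.elim (fun i : {i // i ∈ D} => ⟨i.1, c i.1⟩) (fun i : {i // i ∈ D} => ⟨i.1, c' i.1⟩)))
    (by
      have hs : ∀ {i j : ι} {x : C i} {y : C j}, (⟨i, x⟩ : Σ i, C i) = ⟨j, y⟩ → i = j :=
        fun h => congrArg Sigma.fst h
      rintro (⟨i, hi⟩ | ⟨i, hi⟩ | ⟨i, hi⟩) (⟨j, hj⟩ | ⟨j, hj⟩ | ⟨j, hj⟩) h <;>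
        simp only [Sum.elim_inl, Sum.elim_inr] at h <;> obtain rfl := hs h
      · rfl
      · exact absurd hj hi
      · exact absurd hj hi
      · exact absurd hi hj
      · rfl
      · simp only [Sigma.mk.injEq, heq_eq_eq, true_and] at h
        exact absurd h.symm (hc _ hi)
      · exact absurd hi hj
      · simp only [Sigma.mk.injEq, heq_eq_eq, true_and] at h
        exact absurd h (hc _ hi)
      · rfl)
    (fun j b => b.1)
    (fun j => match j with | .inl i => b i | .inr (.inl i) => a i | .inr (.inr i) => a' i)
  rw [Fintype.prod_sum_type, Fintype.prod_sum_type] at h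
  simp only [law_blockLaw_fst] at h
  rw [mul_assoc]
  refine Eq.trans ?_ h
  refine prob_congr fun x _ => ?_
  simp [Codebook.cloud, Prod.ext_iff, funext_iff]

/-- The number of tuples that differ from `c` exactly in the coordinates in `D`. -/
theorem card_filter_ne_iff_mem (D : Finset ι) (c : ∀ i, C i) :
    (#{c' : ∀ i, C i | ∀ i, c' i ≠ c i ↔ i ∈ D} : ℝ) =
      ∏ i ∈ D, ((Fintype.card (C i) : ℝ) - 1) := by
  have h : ({c' : ∀ i, C i | ∀ i, c' i ≠ c i ↔ i ∈ D} : Finset (∀ i, C i)) =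
      Fintype.piFinset fun i => if i ∈ D then Finset.univ.erase (c i) else {c i} := by
    ext c'
    simp only [Finset.mem_filter, Finset.mem_univ, true_and, Fintype.mem_piFinset]
    refine forall_congr' fun i => ?_
    by_cases hi : i ∈ D <;> simp [hi]
  rw [h, Fintype.card_piFinset, Nat.cast_prod, ← Finset.prod_subset (Finset.subset_univ D)]
  · refine Finset.prod_congr rfl fun i hi => ?_
    rw [if_pos hi, Finset.card_erase_of_mem (Finset.mem_univ _), Finset.card_univ,
      Nat.cast_pred (Fintype.card_pos_iff.2 ⟨c i⟩)]
  · intro i _ hi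
    simp [hi]

/-- The probability that some wrong tuple of cloud centers, with a wrong center for user `o`,
produces the output of the correct codewords. -/
theorem prob_cloud_error_le {Y : Type*} (hP : ∀ i x, 0 ≤ P i x) (hP1 : ∀ i, ∑ x, P i x = 1)
    {F : (∀ i, X i) → Y} (hF : ∀ x, F (fun i => g i (x i)) = F x) (o : ι)
    {θ : Finset ι → ℝ} (hθ : ∀ D, 0 ≤ θ D) (w : ∀ i, C i × N i) :
    prob (bookLaw P g) (fun ω : Codebook X C N => ∃ c' : ∀ i, C i, c' o ≠ (w o).1 ∧
      F (fun i => ω.cloud i (c' i)) = F (fun i => ω.word i (w i))) ≤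
    ∑ D with o ∈ D, (prob (piLaw P) (fun x =>
        θ D < condProb (piLaw P) F (fun x (i : {i // i ∉ D}) => g i (x i)) x) +
      (∏ i ∈ D, ((Fintype.card (C i) : ℝ) - 1)) * θ D) := by
  have hn : ∀ ω : Codebook X C N, 0 ≤ bookLaw P g ω := bookLaw_nonneg hP
  let cp : Finset ι → (∀ i, X i) → ℝ := fun D =>
    condProb (piLaw P) F (fun x (i : {i // i ∉ D}) => g i (x i))
  let E : (∀ i, C i) → Codebook X C N → Prop := fun c' ω =>
    F (fun i => ω.cloud i (c' i)) = F (fun i => ω.word i (w i))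
  -- Wrong tuples are sorted by the exact set `D` of users with a wrong index; the centers outside
  -- `D` are the common part of the collision.
  let W : Finset ι → Finset (∀ i, C i) := fun D =>
    {c' : ∀ i, C i | ∀ i, c' i ≠ (w i).1 ↔ i ∈ D}
  have hE : ∀ D, ∀ c' ∈ W D, prob (bookLaw P g) (fun ω : Codebook X C N =>
      E c' ω ∧ cp D (fun i => ω.word i (w i)) ≤ θ D) ≤ θ D := by
    intro D c' hc'
    simp only [W, Finset.mem_filter, Finset.mem_univ, true_and] at hc'
    -- Writing the output as a function of the centers outside and inside `D` brings it to the form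
    -- required by `prob_collision_le`.
    have hcp : cp D = condProb (piLaw P)
        (fun x => F (merge D (fun i : {i // i ∉ D} => g i (x i))
          (fun i : {i // i ∈ D} => g i (x i))))
        (fun x (i : {i // i ∉ D}) => g i (x i)) := by
      have : (fun x => F (merge D (fun i : {i // i ∉ D} => g i (x i))
          (fun i : {i // i ∈ D} => g i (x i)))) = F := by
        funext x
        rw [merge_restrict D (fun i => g i (x i)) (fun i => g i (x i)) fun _ _ => rfl, hF]
      rw [this]
    rw [hcp]
    exact prob_collision_le
      (μ := piLaw (fun i : {i // i ∉ D} => law (P i) (g i)))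
      (ν := fun _ => piLaw (fun i : {i // i ∈ D} => law (P i) (g i)))
      (piLaw_nonneg fun i => law_nonneg (hP i) _)
      (fun _ => piLaw_nonneg fun i => law_nonneg (hP i) _)
      (sum_piLaw fun i => (sum_law _ _).trans (hP1 i))
      (fun _ _ => sum_piLaw fun i => (sum_law _ _).trans (hP1 i))
      (fun b a => F (merge D b a)) (law_piLaw_split hP1 D) hn
      (law_bookLaw_clouds hP1 D (fun i => (w i).1) c' fun i hi => (hc' i).2 hi)
      (x := fun ω i => ω.word i (w i))
      (fun ω hω => by simp only [Codebook.map_word hω]) (hθ D)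
      (fun ω hω h => by
        have h1 := merge_restrict D (fun i => ω.cloud i (w i).1) (fun i => ω.cloud i (c' i))
          fun i hi => by
            have := mt (hc' i).1 hi
            rw [not_not] at this
            rw [this]
        have h2 := merge_restrict D (fun i => ω.cloud i (w i).1) (fun i => ω.cloud i (w i).1)
          fun _ _ => rfl
        dsimp only
        rw [h1, h2]
        refine Eq.trans h ?_
        rw [← hF]
        simp only [Codebook.map_word hω])
  calc _ ≤ prob (bookLaw P g) (fun ω : Codebook X C N => ∃ D ∈ Finset.univ.filter (o ∈ ·),
        θ D < cp D (fun i => ω.word i (w i)) ∨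
          ∃ c' ∈ W D, E c' ω ∧ cp D (fun i => ω.word i (w i)) ≤ θ D) := by
        refine prob_mono hn ?_
        rintro ω - ⟨c', hc', h⟩
        refine ⟨Finset.univ.filter fun i => c' i ≠ (w i).1, by simpa using hc', ?_⟩
        rcases lt_or_ge (θ (Finset.univ.filter fun i => c' i ≠ (w i).1))
          (cp (Finset.univ.filter fun i => c' i ≠ (w i).1) (fun i => ω.word i (w i)))
          with hl | hl
        · exact Or.inl hl
        · exact Or.inr ⟨c', by simp [W], h, hl⟩
    _ ≤ _ := by
        refine (prob_exists_le hn _ _).trans (Finset.sum_le_sum fun D _ => ?_)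
        refine (prob_or_le hn _ _).trans (add_le_add (le_of_eq ?_) ?_)
        · rw [← law_bookLaw_words hP hP1 w, prob_law]
          simp only [law_bookLaw_words hP hP1 w]
          rfl
        · refine (prob_exists_le hn _ _).trans ((Finset.sum_le_sum (hE D)).trans ?_)
          rw [Finset.sum_const, nsmul_eq_mul, card_filter_ne_iff_mem]

/-- The probability that some wrong message of user `i` produces the output of the correct
codeword. -/
theorem prob_word_error_le {Y : Type*} (hP : ∀ i x, 0 ≤ P i x) (hP1 : ∀ i, ∑ x, P i x = 1)
    (i : ι) (f : X i → Y) {θ θ' : ℝ} (hθ : 0 ≤ θ) (hθ' : 0 ≤ θ') (w : C i × N i) :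
    prob (bookLaw P g) (fun ω : Codebook X C N => ∃ w', w' ≠ w ∧
      f (ω.word i w') = f (ω.word i w)) ≤
    (prob (P i) (fun x => θ < condProb (P i) f (fun _ => ()) x) +
      ((Fintype.card (C i) : ℝ) - 1) * Fintype.card (N i) * θ) +
    (prob (P i) (fun x => θ' < condProb (P i) f (g i) x) +
      ((Fintype.card (N i) : ℝ) - 1) * θ') := by
  have hn : ∀ ω : Codebook X C N, 0 ≤ bookLaw P g ω := bookLaw_nonneg hP
  let E : C i × N i → Codebook X C N → Prop := fun w' ω => f (ω.word i w') = f (ω.word i w)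
  -- A wrong cloud index makes the whole codeword independent of the true one, and the unconditional
  -- law of the output counts. With the right cloud and a wrong satellite, the center is shared, and
  -- the law given `g i` counts.
  let W : Finset (C i × N i) := (Finset.univ.erase w.1) ×ˢ Finset.univ
  let W' : Finset (N i) := Finset.univ.erase w.2
  have hE : ∀ w' ∈ W, prob (bookLaw P g) (fun ω : Codebook X C N =>
      E w' ω ∧ condProb (P i) f (fun _ => ()) (ω.word i w) ≤ θ) ≤ θ := by
    intro w' hw'
    have hne : w.1 ≠ w'.1 := by
      simp only [W, Finset.mem_product, Finset.mem_erase] at hw'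
      exact hw'.1.1.symm
    refine prob_collision_le (μ := fun _ : Unit => 1) (ν := fun _ => P i)
      (fun _ => zero_le_one) (fun _ => hP i) (by simp) (fun _ _ => hP1 i) (fun _ => f)
      (φ := fun x => ((), x)) ?_ hn
      (τ := fun ω => ((), ω.word i w, ω.word i w')) ?_ (x := fun ω => ω.word i w)
      (fun _ _ => rfl) hθ (fun ω _ h => h)
    · intro _ x
      rw [one_mul]
      refine Eq.trans ?_ (congrFun (law_id (P i)) x)
      exact prob_congr fun y _ => by simp
    · intro _ x x'
      rw [one_mul, ← law_bookLaw_words_of_ne (N := N) (g := g) hP hP1 i hne]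
      exact prob_congr fun y _ => by simp
  have hE' : ∀ s ∈ W', prob (bookLaw P g) (fun ω : Codebook X C N =>
      E (w.1, s) ω ∧ condProb (P i) f (g i) (ω.word i w) ≤ θ') ≤ θ' := by
    intro s hs
    exact prob_collision_le (μ := law (P i) (g i)) (ν := fiberLaw (P i) (g i))
      (law_nonneg (hP i) _) (fiberLaw_nonneg (hP i)) ((sum_law _ _).trans (hP1 i))
      (fun _ => sum_fiberLaw) (fun _ => f) (φ := fun x => (g i x, x))
      (fun b a => (law_mul_fiberLaw (hP i) b a).symm) hn
      (law_bookLaw_satellites hP1 i w.1 (Finset.ne_of_mem_erase hs).symm)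
      (x := fun ω => ω.word i w)
      (fun ω hω => by simp only [Codebook.map_word hω, Prod.mk.eta]) hθ' (fun ω _ h => h)
  calc _ ≤ prob (bookLaw P g) (fun ω : Codebook X C N =>
        (θ < condProb (P i) f (fun _ => ()) (ω.word i w) ∨
          ∃ w' ∈ W, E w' ω ∧ condProb (P i) f (fun _ => ()) (ω.word i w) ≤ θ) ∨
        (θ' < condProb (P i) f (g i) (ω.word i w) ∨
          ∃ s ∈ W', E (w.1, s) ω ∧ condProb (P i) f (g i) (ω.word i w) ≤ θ')) := by
        refine prob_mono hn ?_
        rintro ω - ⟨⟨c', s'⟩, hne, h⟩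
        by_cases hc : c' = w.1
        · right
          rcases lt_or_ge θ' (condProb (P i) f (g i) (ω.word i w)) with hl | hl
          · exact Or.inl hl
          · subst hc
            refine Or.inr ⟨s', ?_, h, hl⟩
            simp only [W', Finset.mem_erase, Finset.mem_univ, and_true]
            rintro rfl
            exact hne rfl
        · left
          rcases lt_or_ge θ (condProb (P i) f (fun _ => ()) (ω.word i w)) with hl | hl
          · exact Or.inl hl
          · exact Or.inr ⟨(c', s'), by simp [W, hc], h, hl⟩
    _ ≤ _ := by
        have hw := law_bookLaw_word (C := C) (N := N) (g := g) hP hP1 i w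
        refine (prob_or_le hn _ _).trans (add_le_add ?_ ?_)
        · refine (prob_or_le hn _ _).trans (add_le_add (le_of_eq ?_) ?_)
          · conv_rhs => rw [← hw, prob_law]
            simp only [hw]
          · refine (prob_exists_le hn _ _).trans ((Finset.sum_le_sum hE).trans ?_)
            rw [Finset.sum_const, nsmul_eq_mul, Finset.card_product,
              Finset.card_erase_of_mem (Finset.mem_univ _), Finset.card_univ, Finset.card_univ,
              Nat.cast_mul, Nat.cast_pred (Fintype.card_pos_iff.2 ⟨w.1⟩)]
        · refine (prob_or_le hn _ _).trans (add_le_add (le_of_eq ?_) ?_)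
          · conv_rhs => rw [← hw, prob_law]
            simp only [hw]
          · refine (prob_exists_le hn _ _).trans ((Finset.sum_le_sum hE').trans ?_)
            rw [Finset.sum_const, nsmul_eq_mul,
              Finset.card_erase_of_mem (Finset.mem_univ _), Finset.card_univ,
              Nat.cast_pred (Fintype.card_pos_iff.2 ⟨w.2⟩)]

end Codebook

/-! ### Existence of codes -/

/-- The random coding argument: some codebook does no worse than the average. It is chosen with
nonzero weight because only then do satellites lie over their centers. -/
theorem exists_card_filter_le {Ω W : Type*} [Fintype Ω] [Fintype W] {q : Ω → ℝ}
    (hq : ∀ ω, 0 ≤ q ω) (hq1 : ∑ ω, q ω = 1) (E : Ω → W → Prop) {β : ℝ}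
    (h : ∀ w, prob q (fun ω => E ω w) ≤ β) :
    ∃ ω, q ω ≠ 0 ∧ prob (fun _ => (1 : ℝ)) (E ω) ≤ β * Fintype.card W := by
  classical
  by_contra! hlt
  have h1 : ∑ ω, q ω * prob (fun _ => (1 : ℝ)) (E ω) ≤ β * Fintype.card W := by
    calc _ = ∑ w, prob q (fun ω => E ω w) := by
          simp only [prob_eq_sum_ite, Finset.mul_sum]
          rw [Finset.sum_comm]
          simp
      _ ≤ ∑ _w : W, β := Finset.sum_le_sum fun w _ => h w
      _ = _ := by simp [mul_comm]
  have h2 : β * Fintype.card W < ∑ ω, q ω * prob (fun _ => (1 : ℝ)) (E ω) := by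
    calc β * Fintype.card W = ∑ ω, q ω * (β * Fintype.card W) := by
          rw [← Finset.sum_mul, hq1, one_mul]
      _ < _ := by
        refine Finset.sum_lt_sum (fun ω _ => ?_) ?_
        · by_cases h0 : q ω = 0
          · simp [h0]
          · exact mul_le_mul_of_nonneg_left (hlt ω h0).le (hq ω)
        obtain ⟨ω, -, hω⟩ := Finset.exists_ne_zero_of_sum_ne_zero
          (hq1.trans_ne one_ne_zero : ∑ ω, q ω ≠ 0)
        exact ⟨ω, Finset.mem_univ ω,
          mul_lt_mul_of_pos_left (hlt ω hω) ((hq ω).lt_of_ne' hω)⟩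
  exact absurd h1 h2.not_ge

/-! ### Random superposition codes over several channel uses -/

section Code

variable {n : ℕ} {X Y : Fin (n + 1) → Type*} {V : Type*}

/-- A code whose channel uses and messages are indexed by arbitrary finite types. -/
theorem exists_code_of_fintype (C : Channel X Y V) {τ : Type*} [Fintype τ] [Nonempty τ]
    {W : Fin (n + 1) → Type*} [∀ i, Fintype (W i)] [∀ i, Nonempty (W i)]
    (enc : ∀ i, W i → τ → X i) (dec : ∀ i, (τ → Y i) → W i) :
    ∃ c : Code X Y, c.T = Fintype.card τ ∧ (∀ i, c.M i = Fintype.card (W i)) ∧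
      c.errorProb C = prob (fun _ => (1 : ℝ)) (fun w : ∀ i, W i =>
        ∃ i, dec i (fun t => C.y (fun j => enc j (w j) t) i) ≠ w i) /
          ∏ i, (Fintype.card (W i) : ℝ) := by
  classical
  let eτ := Fintype.equivFin τ
  let eW := fun i => Fintype.equivFin (W i)
  refine ⟨⟨Fintype.card τ, Fintype.card_pos, fun i => Fintype.card (W i),
    fun i => Fintype.card_pos, fun i m t => enc i ((eW i).symm m) (eτ.symm t),
    fun i y => eW i (dec i fun t => y (eτ t))⟩, rfl, fun _ => rfl, ?_⟩
  rw [Code.errorProb]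
  congr 1
  rw [prob, Finset.sum_const, nsmul_one]
  congr 1
  refine Finset.card_equiv (Equiv.piCongrRight fun i => (eW i).symm) fun w => ?_
  simp only [Finset.mem_filter, Finset.mem_univ, true_and]
  refine exists_congr fun i => ?_
  simp only [Code.decoded, Equiv.symm_apply_apply, ne_eq, Equiv.piCongrRight_apply, Pi.map_apply]
  rw [not_iff_not, ← Equiv.eq_symm_apply]

/-- The probability, for independent channel uses with input laws `p t`, that the conditional
probability of `A` given `B` exceeds `θ`. -/
noncomputable def tailProb {τ : Type*} [Fintype τ] [DecidableEq τ] [∀ i, Fintype (X i)]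
    (p : τ → ∀ i, X i → ℝ) {α β : Type*} (A : (∀ i, X i) → α) (B : (∀ i, X i) → β) (θ : ℝ) : ℝ :=
  prob (piLaw fun t => prodLaw (p t)) fun x =>
    θ < ∏ t, condProb (prodLaw (p t)) A B (x t)

variable [∀ i, Fintype (X i)]

theorem sum_prodLaw {p : ∀ i, X i → ℝ} (hp : ∀ i, p i ∈ stdSimplex ℝ (X i)) :
    ∑ x, prodLaw p x = 1 :=
  sum_piLaw fun i => (hp i).2

theorem prodLaw_nonneg {p : ∀ i, X i → ℝ} (hp : ∀ i, p i ∈ stdSimplex ℝ (X i))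
    (x : ∀ i, X i) : 0 ≤ prodLaw p x :=
  piLaw_nonneg (fun i => (hp i).1) x

section Tensor

variable {τ : Type*} [Fintype τ] [DecidableEq τ] {p : τ → ∀ i, X i → ℝ}
  (hp : ∀ t i, p t i ∈ stdSimplex ℝ (X i))

include hp

/-- Codebooks draw the whole codeword of each user, whereas densities multiply over channel uses.
Transposing the array of users and uses turns one product law into the other. -/
theorem prob_condProb_words_eq {α : Type*} (F : (∀ i, X i) → α) (g : ∀ i, X i → X i)
    (D : Finset (Fin (n + 1))) (θ : ℝ) :
    prob (piLaw fun i => piLaw fun t => p t i) (fun x : ∀ i, τ → X i =>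
      θ < condProb (piLaw fun i => piLaw fun t => p t i) (fun x t => F fun i => x i t)
        (fun x (i : {i // i ∉ D}) t => g i (x i t)) x) =
    tailProb p F (fun x (i : {i // i ∉ D}) => g i (x i)) θ := by
  classical
  have hlaw : law (piLaw fun i => piLaw fun t => p t i) (fun (x : ∀ i, τ → X i) t i => x i t) =
      piLaw fun t => prodLaw (p t) := by
    funext z
    refine (law_equiv _ (Equiv.piComm fun (i : Fin (n + 1)) (_ : τ) => X i) z).trans ?_
    exact Finset.prod_comm
  rw [tailProb, ← hlaw, prob_law]
  refine prob_congr fun x _ => ?_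
  rw [← condProb_piLaw (fun t => sum_prodLaw (hp t)), ← hlaw,
    ← condProb_comp (piLaw fun i => piLaw fun t => p t i) (fun (x : ∀ i, τ → X i) t i => x i t)
      (fun z t => F (z t)) (fun z t (i : {i // i ∉ D}) => g i (z t i)) x]
  rw [condProb_congr (A' := fun (x : ∀ i, τ → X i) t => F fun i => x i t)
    (B' := fun (x : ∀ i, τ → X i) t (i : {i // i ∉ D}) => g i (x i t))]
  · exact fun _ _ => Iff.rfl
  · intro x x'
    simp only [funext_iff]
    exact forall_comm

theorem prob_condProb_word_eq (i : Fin (n + 1)) {α β : Type*} (f : X i → α) (b : X i → β)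
    (θ : ℝ) :
    prob (piLaw fun t => p t i) (fun x : τ → X i =>
      θ < condProb (piLaw fun t => p t i) (fun x t => f (x t)) (fun x t => b (x t)) x) =
    tailProb p (fun x => f (x i)) (fun x => b (x i)) θ := by
  classical
  have hlaw : law (piLaw fun t => prodLaw (p t)) (fun (z : τ → ∀ i, X i) t => z t i) =
      piLaw fun t => p t i := by
    funext x
    refine (law_piLaw_comp (fun t => sum_prodLaw (hp t)) (e := id) Function.injective_id
      (fun t z => z i) x).trans ?_
    refine Finset.prod_congr rfl fun t _ => ?_
    have h := law_piLaw_eval (fun i => (hp t i).2) i fun x => x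
    rw [law_id] at h
    exact congrFun h (x t)
  rw [tailProb]
  conv_lhs => rw [← hlaw]
  rw [prob_law]
  refine prob_congr fun z _ => ?_
  rw [← condProb_piLaw (fun t => sum_prodLaw (hp t))]
  have h := condProb_comp (piLaw fun t => prodLaw (p t)) (fun (z : τ → ∀ i, X i) t => z t i)
    (fun x t => f (x t)) (fun x t => b (x t)) z
  rw [h]

end Tensor

/-- Random superposition coding: clouds of user `i` are indexed by `M i` values and satellites by
`L i` values. -/
theorem exists_code_errorProb_le (C : Channel X Y V) {g : ∀ i, X i → X i}
    (hg : ∀ x, C.y (fun i => g i (x i)) 0 = C.y x 0)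
    {τ : Type*} [Fintype τ] [DecidableEq τ] [Nonempty τ] {p : τ → ∀ i, X i → ℝ}
    (hp : ∀ t i, p t i ∈ stdSimplex ℝ (X i)) {M L : Fin (n + 1) → ℕ} (hM : ∀ i, 0 < M i)
    (hL : ∀ i, 0 < L i) (hL0 : L 0 = 1) {θ : Finset (Fin (n + 1)) → ℝ} (hθ : ∀ D, 0 ≤ θ D)
    {θ₁ θ₂ : Fin n → ℝ} (hθ₁ : ∀ i, 0 ≤ θ₁ i) (hθ₂ : ∀ i, 0 ≤ θ₂ i) :
    ∃ c : Code X Y, c.T = Fintype.card τ ∧ (∀ i, c.M i = M i * L i) ∧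
      c.errorProb C ≤
        ∑ D with 0 ∈ D, (tailProb p (fun x => C.y x 0)
          (fun x (i : {i // i ∉ D}) => g i (x i)) (θ D) + (∏ i ∈ D, ((M i : ℝ) - 1)) * θ D) +
        ∑ i : Fin n, ((tailProb p (fun x => C.y x i.succ) (fun _ => ()) (θ₁ i) +
            ((M i.succ : ℝ) - 1) * L i.succ * θ₁ i) +
          (tailProb p (fun x => C.y x i.succ) (fun x => g i.succ (x i.succ)) (θ₂ i) +
            ((L i.succ : ℝ) - 1) * θ₂ i)) := by
  classical
  have hMn : ∀ i, Nonempty (Fin (M i)) := fun i => ⟨⟨0, hM i⟩⟩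
  have hLn : ∀ i, Nonempty (Fin (L i)) := fun i => ⟨⟨0, hL i⟩⟩
  -- The first user has one satellite per cloud, so its cloud index is its message.
  have hLs : Subsingleton (Fin (L 0)) := by rw [hL0]; infer_instance
  let P : ∀ i, (τ → X i) → ℝ := fun i => piLaw fun t => p t i
  let G : ∀ i, (τ → X i) → τ → X i := fun i x t => g i (x t)
  let F : (∀ i, τ → X i) → τ → Y 0 := fun x t => C.y (fun i => x i t) 0
  let f : ∀ i : Fin n, (τ → X i.succ) → τ → Y i.succ := fun i x t => C.out i (x t)
  have hP : ∀ i x, 0 ≤ P i x := fun i => piLaw_nonneg fun t => (hp t i).1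
  have hP1 : ∀ i, ∑ x, P i x = 1 := fun i => sum_piLaw fun t => (hp t i).2
  have hF : ∀ x, F (fun i => G i (x i)) = F x := fun x => funext fun t => hg fun i => x i t
  let Bk := Codebook (fun i => τ → X i) (fun i => Fin (M i)) (fun i => Fin (L i))
  let E0 : Bk → (∀ i, Fin (M i) × Fin (L i)) → Prop := fun ω w =>
    ∃ c' : ∀ i, Fin (M i), c' 0 ≠ (w 0).1 ∧
      F (fun i => ω.cloud i (c' i)) = F (fun i => ω.word i (w i))
  let E1 : Bk → (∀ i, Fin (M i) × Fin (L i)) → Fin n → Prop := fun ω w i =>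
    ∃ w', w' ≠ w i.succ ∧ f i (ω.word _ w') = f i (ω.word _ (w i.succ))
  obtain ⟨ω, hω0, hω⟩ : ∃ ω : Bk, (bookLaw P G ω ≠ 0) ∧
      prob (fun _ => (1 : ℝ)) (fun w => E0 ω w ∨ ∃ i ∈ Finset.univ, E1 ω w i) ≤
        (∑ D with 0 ∈ D, (tailProb p (fun x => C.y x 0)
          (fun x (i : {i // i ∉ D}) => g i (x i)) (θ D) + (∏ i ∈ D, ((M i : ℝ) - 1)) * θ D) +
        ∑ i : Fin n, ((tailProb p (fun x => C.y x i.succ) (fun _ => ()) (θ₁ i) +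
            ((M i.succ : ℝ) - 1) * L i.succ * θ₁ i) +
          (tailProb p (fun x => C.y x i.succ) (fun x => g i.succ (x i.succ)) (θ₂ i) +
            ((L i.succ : ℝ) - 1) * θ₂ i))) *
          Fintype.card (∀ i, Fin (M i) × Fin (L i)) := by
    refine exists_card_filter_le (bookLaw_nonneg hP) (sum_bookLaw hP1) _ fun w => ?_
    refine (prob_or_le (bookLaw_nonneg hP) _ _).trans (add_le_add ?_ ?_)
    · refine (prob_cloud_error_le hP hP1 hF 0 hθ w).trans
        (Finset.sum_le_sum fun D _ => add_le_add (le_of_eq ?_) (le_of_eq ?_))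
      · exact prob_condProb_words_eq hp (fun x => C.y x 0) g D (θ D)
      · simp only [Fintype.card_fin]
    · refine (prob_exists_le (bookLaw_nonneg hP) _ _).trans (Finset.sum_le_sum fun i _ => ?_)
      refine (prob_word_error_le (C := fun i => Fin (M i)) (N := fun i => Fin (L i)) hP hP1
        i.succ (f i) (hθ₁ i) (hθ₂ i) (w i.succ)).trans
        (add_le_add (add_le_add (le_of_eq ?_) (le_of_eq ?_))
          (add_le_add (le_of_eq ?_) (le_of_eq ?_)))
      · rw [condProb_congr (P i.succ) (B' := fun (_ : τ → X i.succ) (_ : τ) => ()) (A' := f i)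
          (fun _ _ => Iff.rfl) (fun _ _ => by simp)]
        exact prob_condProb_word_eq hp i.succ (C.out i) (fun _ => ()) (θ₁ i)
      · simp only [Fintype.card_fin]
      · exact prob_condProb_word_eq hp i.succ (C.out i) (g i.succ) (θ₂ i)
      · simp only [Fintype.card_fin]
  -- Each decoder picks any candidate that explains the output. The true one always does, so the
  -- arbitrary defaults are irrelevant, and a wrong decision exhibits a collision. Wrong centers of
  -- other users do no harm at receiver 1.
  let dec : ∀ i, (τ → Y i) → Fin (M i) × Fin (L i) := Fin.cons
    (fun y => if h : ∃ c' : ∀ i, Fin (M i), F (fun i => ω.cloud i (c' i)) = y then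
      (h.choose 0, Classical.arbitrary _) else Classical.arbitrary _)
    (fun i y => if h : ∃ w', f i (ω.word i.succ w') = y then h.choose else Classical.arbitrary _)
  obtain ⟨c, hT, hc, herr⟩ := exists_code_of_fintype C (fun i w => ω.word i w) dec
  refine ⟨c, hT, fun i => by simp [hc], ?_⟩
  rw [herr, div_le_iff₀ (Finset.prod_pos fun i _ => Nat.cast_pos.2 Fintype.card_pos)]
  have hcard : (∏ i, (Fintype.card (Fin (M i) × Fin (L i)) : ℝ)) =
      Fintype.card (∀ i, Fin (M i) × Fin (L i)) := by
    rw [Fintype.card_pi, Nat.cast_prod]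
  rw [hcard]
  refine (prob_mono (fun _ => zero_le_one) ?_).trans hω
  rintro w - ⟨i, hi⟩
  refine Fin.cases (fun h0 => Or.inl ?_) (fun i hi => Or.inr ⟨i, Finset.mem_univ i, ?_⟩) i hi
  · have h : ∃ c' : ∀ i, Fin (M i), F (fun i => ω.cloud i (c' i)) =
        F (fun i => ω.word i (w i)) := by
      refine ⟨fun i => (w i).1, ?_⟩
      rw [← hF fun i => ω.word i (w i)]
      simp only [Codebook.map_word hω0]
    refine ⟨h.choose, fun he => h0 ?_, h.choose_spec⟩
    refine Eq.trans (dif_pos h) ?_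
    exact Prod.ext he (Subsingleton.elim _ _)
  · have h : ∃ w', f i (ω.word i.succ w') = f i (ω.word i.succ (w i.succ)) := ⟨_, rfl⟩
    refine ⟨h.choose, fun he => hi ?_, h.choose_spec⟩
    exact Eq.trans (dif_pos h) he

end Code

/-! ### Concentration of the information density -/

section Concentration

variable {τ Ω : Type*} [Fintype τ] [DecidableEq τ] [Fintype Ω] {q : τ → Ω → ℝ}

/-- Independence and zero mean kill the cross terms, so variances add. -/
theorem sum_piLaw_mul_sq_sum (hq1 : ∀ t, ∑ ω, q t ω = 1) {φ : τ → Ω → ℝ}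
    (hφ : ∀ t, ∑ ω, q t ω * φ t ω = 0) :
    ∑ x, piLaw q x * (∑ t, φ t (x t)) ^ 2 = ∑ t, ∑ ω, q t ω * φ t ω ^ 2 := by
  classical
  have hcross : ∀ t s, ∑ x, piLaw q x * (φ t (x t) * φ s (x s)) =
      if t = s then ∑ ω, q t ω * φ t ω ^ 2 else 0 := by
    intro t s
    split_ifs with hts
    · subst hts
      rw [← law_id (q t), ← law_piLaw_eval hq1 t fun ω => ω,
        sum_law_mul _ _ fun ω => φ t ω ^ 2]
      simp only [sq]
    · have h := sum_piLaw_mul_prod q fun k ω => if k ∈ ({t, s} : Finset τ) then φ k ω else 1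
      rw [Finset.prod_eq_zero (Finset.mem_univ t) (by simpa using hφ t)] at h
      rw [← h]
      refine Finset.sum_congr rfl fun x _ => ?_
      rw [Finset.prod_ite_mem, Finset.univ_inter, Finset.prod_pair hts]
  have hsq : ∀ x : τ → Ω, (∑ t, φ t (x t)) ^ 2 = ∑ t, ∑ s, φ t (x t) * φ s (x s) := fun x => by
    rw [sq, Finset.sum_mul_sum]
  simp only [hsq, Finset.mul_sum]
  rw [Finset.sum_comm]
  refine Finset.sum_congr rfl fun t _ => ?_
  rw [Finset.sum_comm]
  simp only [hcross]
  simp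

/-- Chebyshev's inequality for a sum of independent centered variables. -/
theorem prob_lt_sum_le (hq : ∀ t ω, 0 ≤ q t ω) (hq1 : ∀ t, ∑ ω, q t ω = 1) {φ : τ → Ω → ℝ}
    (hφ : ∀ t, ∑ ω, q t ω * φ t ω = 0) {δ : ℝ} (hδ : 0 < δ) :
    prob (piLaw q) (fun x => δ < ∑ t, φ t (x t)) ≤ (∑ t, ∑ ω, q t ω * φ t ω ^ 2) / δ ^ 2 := by
  classical
  rw [le_div_iff₀ (by positivity), ← sum_piLaw_mul_sq_sum hq1 hφ, prob_eq_sum_ite,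
    Finset.sum_mul]
  refine Finset.sum_le_sum fun x _ => ?_
  have hx := piLaw_nonneg hq x
  split_ifs with h
  · gcongr
  · rw [zero_mul]
    positivity

/-- The expected information density of `A` given `B`, in bits. -/
noncomputable def expDensity {α β : Type*} (q : Ω → ℝ) (A : Ω → α) (B : Ω → β) : ℝ :=
  -∑ ω, q ω * Real.logb 2 (condProb q A B ω)

/-- The variance of the information density of `A` given `B`. -/
noncomputable def varDensity {α β : Type*} (q : Ω → ℝ) (A : Ω → α) (B : Ω → β) : ℝ :=
  ∑ ω, q ω * (Real.logb 2 (condProb q A B ω) + expDensity q A B) ^ 2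

/-- Taking logarithms turns the product into a sum of independent information densities, to which
Chebyshev applies after centering. -/
theorem prob_lt_prod_condProb_le {α β : Type*} (hq : ∀ t ω, 0 ≤ q t ω)
    (hq1 : ∀ t, ∑ ω, q t ω = 1) (A : Ω → α) (B : Ω → β) {δ : ℝ} (hδ : 0 < δ) :
    prob (piLaw q) (fun x => (2 : ℝ) ^ (-(∑ t, expDensity (q t) A B - δ)) <
      ∏ t, condProb (q t) A B (x t)) ≤ (∑ t, varDensity (q t) A B) / δ ^ 2 := by
  have h := prob_lt_sum_le hq hq1
    (φ := fun t ω => Real.logb 2 (condProb (q t) A B ω) + expDensity (q t) A B)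
    (fun t => by
      simp only [mul_add, Finset.sum_add_distrib, ← Finset.sum_mul, hq1, one_mul]
      simp [expDensity]) hδ
  refine (prob_mono (piLaw_nonneg hq) fun x hx hlt => ?_).trans h
  have hpos : ∀ t, 0 < condProb (q t) A B (x t) := fun t =>
    condProb_pos (hq t) A B (piLaw_ne_zero hx t)
  have hlog := Real.logb_lt_logb one_lt_two (Real.rpow_pos_of_pos two_pos _) hlt
  rw [Real.logb_rpow two_pos (by norm_num), Real.logb_prod _ _ fun t _ => (hpos t).ne'] at hlog
  rw [Finset.sum_add_distrib]
  linarith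

end Concentration

/-! ### Achievable rates -/

section Achievable

open Filter Topology

variable {n : ℕ} {X Y : Fin (n + 1) → Type*} {V : Type*} [∀ i, Fintype (X i)]
  {σ : Type*} [Fintype σ] [DecidableEq σ] {p : σ → ∀ i, X i → ℝ}

theorem tailProb_nonneg (hp : ∀ s i, p s i ∈ stdSimplex ℝ (X i)) {α β : Type*}
    (A : (∀ i, X i) → α) (B : (∀ i, X i) → β) (θ : ℝ) : 0 ≤ tailProb p A B θ := by
  rw [tailProb]
  exact prob_nonneg (piLaw_nonneg fun s => prodLaw_nonneg (hp s)) _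

theorem tailProb_le (hp : ∀ s i, p s i ∈ stdSimplex ℝ (X i)) {α β : Type*}
    (A : (∀ i, X i) → α) (B : (∀ i, X i) → β) {δ : ℝ} (hδ : 0 < δ) :
    tailProb p A B (2 ^ (-(∑ s, expDensity (prodLaw (p s)) A B - δ))) ≤
      (∑ s, varDensity (prodLaw (p s)) A B) / δ ^ 2 := by
  rw [tailProb]
  exact prob_lt_prod_condProb_le (fun s => prodLaw_nonneg (hp s)) (fun s => sum_prodLaw (hp s))
    A B hδ

/-- For a list of slots that is repeated `m + 1` times, there are thresholds for which both the
probability of an atypical output and the expected number of collisions vanish. -/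
theorem exists_threshold (hp : ∀ s i, p s i ∈ stdSimplex ℝ (X i)) {α β : Type*}
    (A : (∀ i, X i) → α) (B : (∀ i, X i) → β) {k : ℕ → ℝ} (hk : ∀ m, 0 ≤ k m) {r : ℝ}
    (h : (∀ m, k m = 0) ∨ r < ∑ s, expDensity (prodLaw (p s)) A B ∧
      ∀ m : ℕ, k m ≤ 2 ^ ((m + 1 : ℝ) * r)) :
    ∃ θ : ℕ → ℝ, (∀ m, 0 ≤ θ m) ∧ Tendsto (fun m =>
      tailProb (fun t : Fin (m + 1) × σ => p t.2) A B (θ m) + k m * θ m) atTop (𝓝 0) := by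
  set H := ∑ s, expDensity (prodLaw (p s)) A B with hH
  -- Half of the gap between `r` and `H` goes to the deviation and half to the decay: collisions
  -- contribute at most 2^(-(m+1)δ), atypical outputs O(1/(m+1)). At rate zero there may be no gap,
  -- but there are no wrong candidates either.
  obtain ⟨δ, hδ, hδr⟩ : ∃ δ : ℝ, 0 < δ ∧ ((∀ m, k m = 0) ∨ r + δ ≤ H - δ ∧
      ∀ m : ℕ, k m ≤ 2 ^ ((m + 1 : ℝ) * r)) := by
    rcases h with h | ⟨h, h'⟩
    · exact ⟨1, one_pos, Or.inl h⟩
    · exact ⟨(H - r) / 2, by linarith, Or.inr ⟨by linarith, h'⟩⟩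
  let θ : ℕ → ℝ := fun m => 2 ^ (-((m + 1 : ℝ) * H - (m + 1) * δ))
  have hθ : ∀ m, 0 ≤ θ m := fun m => (Real.rpow_pos_of_pos two_pos _).le
  refine ⟨θ, hθ, ?_⟩
  rw [← add_zero (0 : ℝ)]
  refine Tendsto.add ?_ ?_
  · have hlim : Tendsto (fun m : ℕ =>
        (∑ s, varDensity (prodLaw (p s)) A B) / δ ^ 2 * (1 / ((m : ℝ) + 1))) atTop (𝓝 0) := by
      simpa using tendsto_one_div_add_atTop_nhds_zero_nat.const_mul
        ((∑ s, varDensity (prodLaw (p s)) A B) / δ ^ 2)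
    have hle : ∀ m : ℕ, tailProb (fun t : Fin (m + 1) × σ => p t.2) A B (θ m) ≤
        (∑ s, varDensity (prodLaw (p s)) A B) / δ ^ 2 * (1 / ((m : ℝ) + 1)) := by
      intro m
      have hm : (0 : ℝ) < (m : ℝ) + 1 := by positivity
      have h := tailProb_le (p := fun t : Fin (m + 1) × σ => p t.2) (fun t => hp t.2) A B
        (mul_pos hm hδ)
      simp only [Fintype.sum_prod_type, Finset.sum_const, Finset.card_univ, Fintype.card_fin,
        nsmul_eq_mul, Nat.cast_add, Nat.cast_one, ← hH] at h
      refine h.trans (le_of_eq ?_)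
      field_simp
    have hge : ∀ m : ℕ, 0 ≤ tailProb (fun t : Fin (m + 1) × σ => p t.2) A B (θ m) := fun m =>
      tailProb_nonneg (p := fun t : Fin (m + 1) × σ => p t.2) (fun t => hp t.2) A B (θ m)
    exact squeeze_zero hge hle hlim
  · rcases hδr with h0 | ⟨hr, hkm⟩
    · simp [h0]
    · have hlim : Tendsto (fun m : ℕ => ((2 : ℝ) ^ (-δ)) ^ (m + 1)) atTop (𝓝 0) :=
        (tendsto_pow_atTop_nhds_zero_of_lt_one (Real.rpow_pos_of_pos two_pos _).le
          (Real.rpow_lt_one_of_one_lt_of_neg one_lt_two (by linarith))).comp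
          (tendsto_add_atTop_nat 1)
      refine squeeze_zero (fun m => mul_nonneg (hk m) (hθ m)) (fun m => ?_) hlim
      have hm : (0 : ℝ) < (m : ℝ) + 1 := by positivity
      refine (mul_le_mul_of_nonneg_right (hkm m) (hθ m)).trans ?_
      rw [← Real.rpow_add two_pos, ← Real.rpow_natCast, ← Real.rpow_mul two_pos.le]
      refine Real.rpow_le_rpow_of_exponent_le one_le_two ?_
      push_cast
      nlinarith

/-- Rates obtained from superposition codes with `a i` cloud bits and `b i` satellite bits per
pass through the slots `σ`. -/
theorem Channel.achievable_of_lt (C : Channel X Y V) {g : ∀ i, X i → X i}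
    (hg : ∀ x, C.y (fun i => g i (x i)) 0 = C.y x 0) [Nonempty σ]
    (hp : ∀ s i, p s i ∈ stdSimplex ℝ (X i)) {a b : Fin (n + 1) → ℕ} (hb : b 0 = 0)
    (h0 : 0 < a 0 → ∀ D : Finset (Fin (n + 1)), 0 ∈ D → (∑ i ∈ D, a i : ℝ) <
      ∑ s, expDensity (prodLaw (p s)) (fun x => C.y x 0) fun x (i : {i // i ∉ D}) => g i (x i))
    (h1 : ∀ i : Fin n, 0 < a i.succ → (a i.succ + b i.succ : ℝ) <
      ∑ s, expDensity (prodLaw (p s)) (fun x => C.y x i.succ) fun _ => ())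
    (h2 : ∀ i : Fin n, 0 < b i.succ → (b i.succ : ℝ) <
      ∑ s, expDensity (prodLaw (p s)) (fun x => C.y x i.succ) fun x => g i.succ (x i.succ)) :
    C.Achievable fun i => (a i + b i : ℝ) / Fintype.card σ := by
  have hpow : ∀ m d : ℕ, (2 : ℝ) ^ ((m + 1) * d) = 2 ^ ((m + 1 : ℝ) * d) := fun m d => by
    rw [← Real.rpow_natCast]
    push_cast
    rfl
  have hpos : ∀ m d : ℕ, (0 : ℝ) ≤ 2 ^ ((m + 1) * d) - 1 := fun m d =>
    sub_nonneg.2 (one_le_pow₀ one_le_two)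
  have hT0 : ∀ D : Finset (Fin (n + 1)), ∃ θ : ℕ → ℝ, (∀ m, 0 ≤ θ m) ∧ (0 ∈ D →
      Tendsto (fun m => tailProb (fun t : Fin (m + 1) × σ => p t.2) (fun x => C.y x 0)
        (fun x (i : {i // i ∉ D}) => g i (x i)) (θ m) +
          (∏ i ∈ D, ((2 : ℝ) ^ ((m + 1) * a i) - 1)) * θ m) atTop (𝓝 0)) := by
    intro D
    by_cases hD : 0 ∈ D
    · obtain ⟨θ, hθ, hlim⟩ := exists_threshold hp (fun x => C.y x 0)
        (fun x (i : {i // i ∉ D}) => g i (x i))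
        (k := fun m => ∏ i ∈ D, ((2 : ℝ) ^ ((m + 1) * a i) - 1))
        (fun m => Finset.prod_nonneg fun i _ => hpos m _) (r := ∑ i ∈ D, (a i : ℝ)) (by
          rcases Nat.eq_zero_or_pos (a 0) with ha | ha
          · exact Or.inl fun m => Finset.prod_eq_zero hD (by simp [ha])
          · refine Or.inr ⟨h0 ha D hD, fun m => ?_⟩
            rw [Finset.mul_sum, Real.rpow_sum_of_pos two_pos]
            refine Finset.prod_le_prod (fun i _ => hpos m _) fun i _ => ?_
            rw [← hpow]
            linarith)
      exact ⟨θ, hθ, fun _ => hlim⟩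
    · exact ⟨0, fun _ => le_rfl, fun h => absurd h hD⟩
  have hT1 : ∀ i : Fin n, ∃ θ : ℕ → ℝ, (∀ m, 0 ≤ θ m) ∧
      Tendsto (fun m => tailProb (fun t : Fin (m + 1) × σ => p t.2) (fun x => C.y x i.succ)
        (fun _ => ()) (θ m) +
        (((2 : ℝ) ^ ((m + 1) * a i.succ) - 1) * 2 ^ ((m + 1) * b i.succ)) * θ m)
        atTop (𝓝 0) := by
    intro i
    refine exists_threshold hp _ _ (fun m => mul_nonneg (hpos m _) (by positivity))
      (r := a i.succ + b i.succ) ?_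
    rcases Nat.eq_zero_or_pos (a i.succ) with ha | ha
    · exact Or.inl fun m => by simp [ha]
    · refine Or.inr ⟨h1 i ha, fun m => ?_⟩
      rw [mul_add, Real.rpow_add two_pos, ← hpow, ← hpow]
      gcongr
      linarith
  have hT2 : ∀ i : Fin n, ∃ θ : ℕ → ℝ, (∀ m, 0 ≤ θ m) ∧
      Tendsto (fun m => tailProb (fun t : Fin (m + 1) × σ => p t.2) (fun x => C.y x i.succ)
        (fun x => g i.succ (x i.succ)) (θ m) +
        ((2 : ℝ) ^ ((m + 1) * b i.succ) - 1) * θ m) atTop (𝓝 0) := by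
    intro i
    refine exists_threshold hp _ _ (fun m => hpos m _) (r := b i.succ) ?_
    rcases Nat.eq_zero_or_pos (b i.succ) with ha | ha
    · exact Or.inl fun m => by simp [ha]
    · refine Or.inr ⟨h2 i ha, fun m => ?_⟩
      rw [← hpow]
      linarith
  choose θ hθ hlim using hT0
  choose θ₁ hθ₁ hlim₁ using hT1
  choose θ₂ hθ₂ hlim₂ using hT2
  have hcode := fun m : ℕ => exists_code_errorProb_le C hg
    (p := fun t : Fin (m + 1) × σ => p t.2) (fun t => hp t.2)
    (M := fun i => 2 ^ ((m + 1) * a i)) (L := fun i => 2 ^ ((m + 1) * b i))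
    (fun i => by positivity) (fun i => by positivity) (by simp [hb])
    (fun D => hθ D m) (fun i => hθ₁ i m) (fun i => hθ₂ i m)
  choose c hcT hcM hcE using hcode
  have hσ : 0 < Fintype.card σ := Fintype.card_pos
  have hcT' : ∀ m, (c m).T = (m + 1) * Fintype.card σ := fun m => by
    rw [hcT, Fintype.card_prod, Fintype.card_fin]
  refine ⟨c, fun m => funext fun i => ?_, ?_, ?_⟩
  · rw [Code.rate, hcM, hcT', ← pow_add, ← mul_add]
    push_cast
    rw [Real.logb_pow, Real.logb_self_eq_one one_lt_two]
    push_cast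
    have : (0 : ℝ) < Fintype.card σ := by exact_mod_cast hσ
    field_simp
  · refine tendsto_atTop_mono (fun m => ?_) (tendsto_add_atTop_nat 1)
    rw [hcT']
    exact Nat.le_mul_of_pos_right _ hσ
  · have hsum := (tendsto_finsetSum (Finset.univ.filter (0 ∈ ·)) fun D hD =>
        hlim D (by simpa using hD)).add
      (tendsto_finsetSum Finset.univ fun i _ => (hlim₁ i).add (hlim₂ i))
    simp only [add_zero, Finset.sum_const_zero] at hsum
    refine squeeze_zero (fun m => ?_) (fun m => ?_) hsum
    · exact div_nonneg (Nat.cast_nonneg _) (Finset.prod_nonneg fun _ _ => Nat.cast_nonneg _)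
    · simpa using hcE m

end Achievable

/-! ### Information densities and entropies -/

section Density

variable {Ω α β γ : Type*} [Fintype Ω] {q : Ω → ℝ}

theorem condProb_le_one (hq : ∀ ω, 0 ≤ q ω) (A : Ω → α) (B : Ω → β) (ω : Ω) :
    condProb q A B ω ≤ 1 :=
  div_le_one_of_le₀ (prob_mono hq fun _ _ h => (Prod.ext_iff.1 h).2) (law_nonneg hq _ _)

theorem expDensity_nonneg (hq : ∀ ω, 0 ≤ q ω) (A : Ω → α) (B : Ω → β) :
    0 ≤ expDensity q A B :=
  neg_nonneg.2 (Finset.sum_nonpos fun ω _ => mul_nonpos_of_nonneg_of_nonpos (hq ω)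
    (Real.logb_nonpos one_lt_two (condProb_nonneg hq A B ω) (condProb_le_one hq A B ω)))

/-- The expected likelihood ratio is at most the total mass: weighting the coarser conditional law
by the law of `B` gives a measure of no larger mass. This feeds Gibbs' inequality. -/
theorem sum_mul_condProb_div_le (hq : ∀ ω, 0 ≤ q ω) [Fintype α] [Fintype β] [Fintype γ]
    (A : Ω → α) (B : Ω → β) (r : β → γ) :
    ∑ ω, q ω * (condProb q A (fun ω => r (B ω)) ω / condProb q A B ω) ≤ ∑ ω, q ω := by
  classical
  let l : α × β → ℝ := law q fun ω => (A ω, B ω)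
  let l' : α × γ → ℝ := law q fun ω => (A ω, r (B ω))
  let m : β → ℝ := law q B
  let m' : γ → ℝ := law q fun ω => r (B ω)
  have hl' : ∀ c, ∑ a, l' (a, c) = m' c := fun c => by
    have h := sum_law_mul q (fun ω => (A ω, r (B ω))) fun t => if t.2 = c then 1 else 0
    simp only [mul_ite, mul_one, mul_zero, Fintype.sum_prod_type, Finset.sum_ite_eq',
      Finset.mem_univ, if_true] at h
    rw [h]
    exact (law_eq_sum_ite _ _ _).symm
  calc ∑ ω, q ω * (condProb q A (fun ω => r (B ω)) ω / condProb q A B ω)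
      = ∑ t : α × β, l t * ((l' (t.1, r t.2) / m' (r t.2)) / (l t / m t.2)) :=
        (sum_law_mul q (fun ω => (A ω, B ω))
          fun t => (l' (t.1, r t.2) / m' (r t.2)) / (l t / m t.2)).symm
    _ ≤ ∑ t : α × β, m t.2 * (l' (t.1, r t.2) / m' (r t.2)) := by
        refine Finset.sum_le_sum fun t _ => ?_
        have h0 : 0 ≤ m t.2 * (l' (t.1, r t.2) / m' (r t.2)) :=
          mul_nonneg (law_nonneg hq _ _) (div_nonneg (law_nonneg hq _ _) (law_nonneg hq _ _))
        by_cases hl : l t = 0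
        · simpa [hl] using h0
        · refine le_of_eq ?_
          field_simp
    _ = ∑ b, m b * (m' (r b) / m' (r b)) := by
        rw [Fintype.sum_prod_type_right]
        refine Finset.sum_congr rfl fun b _ => ?_
        dsimp only
        rw [← Finset.mul_sum, ← Finset.sum_div, hl']
    _ ≤ ∑ b, m b := Finset.sum_le_sum fun b _ =>
        mul_le_of_le_one_right (law_nonneg hq _ _) (div_self_le_one _)
    _ = _ := sum_law q B

/-- Conditioning on more decreases entropy. -/
theorem expDensity_le_comp (hq : ∀ ω, 0 ≤ q ω) [Fintype α] [Fintype β] [Fintype γ] (A : Ω → α)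
    (B : Ω → β) (r : β → γ) : expDensity q A B ≤ expDensity q A fun ω => r (B ω) := by
  have hle : ∀ ω, q ω * (Real.logb 2 (condProb q A (fun ω => r (B ω)) ω) -
      Real.logb 2 (condProb q A B ω)) ≤
      q ω * (condProb q A (fun ω => r (B ω)) ω / condProb q A B ω - 1) * (Real.log 2)⁻¹ := by
    intro ω
    by_cases h0 : q ω = 0
    · simp [h0]
    have h1 := condProb_pos hq A (fun ω => r (B ω)) h0
    have h2 := condProb_pos hq A B h0
    rw [← Real.logb_div h1.ne' h2.ne', Real.logb, div_eq_mul_inv _ (Real.log 2), ← mul_assoc]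
    -- Gibbs' inequality, through log x ≤ x - 1 for the ratio of conditional probabilities.
    have := Real.log_le_sub_one_of_pos (div_pos h1 h2)
    have h3 : 0 < Real.log 2 := Real.log_pos one_lt_two
    have h4 := hq ω
    gcongr
  have hsum := Finset.sum_le_sum fun ω (_ : ω ∈ Finset.univ) => hle ω
  have hdiv := sum_mul_condProb_div_le hq A B r
  rw [← Finset.sum_mul] at hsum
  simp only [mul_sub, mul_one, Finset.sum_sub_distrib] at hsum
  have h3 : 0 < (Real.log 2)⁻¹ := inv_pos.2 (Real.log_pos one_lt_two)
  have := mul_nonpos_of_nonpos_of_nonneg (sub_nonpos.2 hdiv) h3.le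
  simp only [expDensity]
  linarith

theorem expDensity_congr {A : Ω → α} {B : Ω → β} {B' : Ω → γ}
    (hB : ∀ ω ω', B ω = B ω' ↔ B' ω = B' ω') : expDensity q A B = expDensity q A B' := by
  rw [expDensity, expDensity, condProb_congr q (A' := A) (fun _ _ => Iff.rfl) hB]

end Density

/-- A choice of a representative in each fiber of `g`. -/
theorem exists_fiber_representative {α β : Type*} (g : α → β) :
    ∃ r : α → α, (∀ x, g (r x) = g x) ∧ ∀ x y, r x = r y ↔ g x = g y := by
  have h : ∀ x, ∃ y, g y = g x := fun x => ⟨x, rfl⟩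
  refine ⟨fun x => (h x).choose, fun x => (h x).choose_spec, fun x y => ⟨fun hxy => ?_, fun hxy => ?_⟩⟩
  · rw [← (h x).choose_spec, ← (h y).choose_spec]
    exact congrArg g hxy
  · simp only [hxy]

/-! ### Rate splitting -/

section Region

open Filter Topology

variable {n : ℕ} {X Y : Fin (n + 1) → Type*} {V : Type*} [∀ i, Fintype (X i)]

/-- A splitting of a rate tuple into cloud rates `rc` and satellite rates `rp` that satisfies the
constraints of superposition coding with auxiliaries `g i (x i)`. -/
structure IsRateSplit (C : Channel X Y V) (g : ∀ i, X i → X i) (p : ∀ i, X i → ℝ)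
    (R rc rp : Fin (n + 1) → ℝ) : Prop where
  add_eq : ∀ i, rc i + rp i = R i
  cloud_nonneg : ∀ i, 0 ≤ rc i
  satellite_nonneg : ∀ i, 0 ≤ rp i
  satellite_zero : rp 0 = 0
  sum_le : ∀ D : Finset (Fin (n + 1)), 0 ∈ D → ∑ i ∈ D, rc i ≤
    expDensity (prodLaw p) (fun x => C.y x 0) fun x (i : {i // i ∉ D}) => g i (x i)
  rate_le : ∀ i : Fin n, rc i.succ + rp i.succ ≤
    expDensity (prodLaw p) (fun x => C.y x i.succ) fun _ => ()
  satellite_le : ∀ i : Fin n, rp i.succ ≤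
    expDensity (prodLaw p) (fun x => C.y x i.succ) fun x => g i.succ (x i.succ)

/-- Filling the satellites up to H(Y_i|U_i) first leaves the least possible load on the clouds, so
the split is explicit and no elimination of variables is needed. -/
theorem exists_isRateSplit [∀ i, Fintype (Y i)] [Fintype V] {U : Fin n → Type*}
    [∀ i, Fintype (U i)] (C : Channel X Y V) {g : ∀ i : Fin n, X i.succ → U i}
    {g' : ∀ i, X i → X i} (hg' : ∀ (i : Fin n) x y, g' i.succ x = g' i.succ y ↔ g i x = g i y)
    {p : ∀ i, X i → ℝ} (hp : ∀ i, p i ∈ stdSimplex ℝ (X i)) {R : Fin (n + 1) → ℝ}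
    (hR : R ∈ C.rateRegion g p) : ∃ rc rp, IsRateSplit C g' p R rc rp := by
  classical
  obtain ⟨hR0, -, hR1, hRS⟩ := hR
  have hq := prodLaw_nonneg hp
  have hq1 := sum_prodLaw hp
  let h : Fin n → ℝ := fun i =>
    expDensity (prodLaw p) (fun x => C.y x i.succ) fun x => g i (x i.succ)
  have hh : ∀ i, 0 ≤ h i := fun i => expDensity_nonneg hq _ _
  have hmono : ∀ S : Finset (Fin n), R 0 + ∑ i ∈ S, max 0 (R i.succ - h i) ≤
      expDensity (prodLaw p) (fun x => C.y x 0) (auxCompl g S) := by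
    intro S
    -- Only users with a positive excess load the clouds. The region's inequality is applied to
    -- `S'`; passing to the larger `S` conditions on fewer auxiliaries and only raises the entropy.
    let S' := S.filter fun i => 0 < R i.succ - h i
    have hsum : ∑ i ∈ S, max 0 (R i.succ - h i) = ∑ i ∈ S', (R i.succ - h i) := by
      rw [Finset.sum_filter]
      refine Finset.sum_congr rfl fun i _ => ?_
      split_ifs with hi
      exacts [max_eq_right hi.le, max_eq_left (not_lt.1 hi)]
    have h1 := hRS S'
    simp only [condEntropy_eq_sum] at h1
    change R 0 + ∑ i ∈ S', R i.succ ≤ expDensity (prodLaw p) (fun x => C.y x 0) (auxCompl g S') +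
      ∑ i ∈ S', h i at h1
    have h2 := expDensity_le_comp hq (fun x => C.y x 0) (auxCompl g S')
      fun (u : ∀ i : {i // i ∉ S'}, U i) (i : {i // i ∉ S}) =>
        u ⟨i.1, fun hi => i.2 (Finset.mem_filter.1 hi).1⟩
    rw [hsum, Finset.sum_sub_distrib]
    refine le_trans ?_ h2
    linarith
  refine ⟨Fin.cons (R 0) fun i => max 0 (R i.succ - h i),
    Fin.cons 0 fun i => min (R i.succ) (h i), ?_, ?_, ?_, rfl, ?_, ?_, ?_⟩
  · refine Fin.cases (by simp) fun i => ?_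
    simp only [Fin.cons_succ]
    rcases le_total (R i.succ) (h i) with hl | hl
    · rw [max_eq_left (by linarith), min_eq_left hl, zero_add]
    · rw [max_eq_right (by linarith), min_eq_right hl, sub_add_cancel]
  · exact Fin.cases (hR0 0) fun i => le_max_left _ _
  · exact Fin.cases le_rfl fun i => le_min (hR0 _) (hh i)
  · intro D hD
    let S : Finset (Fin n) := Finset.univ.filter fun i => i.succ ∈ D
    have hDS : D = insert 0 (S.map (Fin.succEmb n)) := by
      ext i
      refine Fin.cases ?_ (fun i => ?_) i <;> simp [S, hD, Fin.succ_ne_zero]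
    have hsum : ∑ i ∈ D, (Fin.cons (R 0) fun i => max 0 (R i.succ - h i) : Fin (n + 1) → ℝ) i =
        R 0 + ∑ i ∈ S, max 0 (R i.succ - h i) := by
      rw [hDS, Finset.sum_insert (by simp [Fin.succ_ne_zero]), Finset.sum_map]
      simp
    rw [hsum]
    refine (hmono S).trans (le_of_eq (expDensity_congr fun x y => ?_))
    simp only [funext_iff, auxCompl, Subtype.forall]
    constructor
    · intro hxy
      refine Fin.cases (fun h0 => absurd hD h0) fun i hi => ?_
      exact (hg' i _ _).2 (hxy i (by simpa [S] using hi))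
    · intro hxy i hi
      exact (hg' i _ _).1 (hxy i.succ (by simpa [S] using hi))
  · intro i
    simp only [Fin.cons_succ]
    have h1 := hR1 i
    rw [entropy_eq_sum hq1] at h1
    refine le_trans (le_of_eq ?_) h1
    rcases le_total (R i.succ) (h i) with hl | hl
    · rw [max_eq_left (by linarith), min_eq_left hl, zero_add]
    · rw [max_eq_right (by linarith), min_eq_right hl, sub_add_cancel]
  · intro i
    simp only [Fin.cons_succ]
    exact (min_le_right _ _).trans (le_of_eq (expDensity_congr fun x y => (hg' i _ _).symm))

end Region

/-! ### Time sharing and passage to the closure -/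

section TimeSharing

open Filter Topology

/-- A weighted sum of nonnegative terms is bounded by the sum over slots that repeat the index
`i` at least `w i * N` times. -/
theorem mul_sum_le_sum_sigma {κ : Type*} [Fintype κ] {w H : κ → ℝ} (hH : ∀ q, 0 ≤ H q) (N : ℝ) :
    N * ∑ q, w q * H q ≤ ∑ s : Σ q, Fin ⌈w q * N⌉₊, H s.1 := by
  rw [Fintype.sum_sigma, Finset.mul_sum]
  refine Finset.sum_le_sum fun q _ => ?_
  simp only [Finset.sum_const, Finset.card_univ, Fintype.card_fin, nsmul_eq_mul]
  have := mul_le_mul_of_nonneg_right (Nat.le_ceil (w q * N)) (hH q)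
  linarith

/-- The ceilings add at most one slot per index, so the number of slots is asymptotic to `N + 1`. -/
theorem tendsto_floor_div_card_slots {κ : Type*} [Fintype κ] {w : κ → ℝ} (hw : ∀ q, 0 ≤ w q)
    (hw1 : ∑ q, w q = 1) {r : ℝ} (hr : 0 ≤ r) :
    Tendsto (fun N : ℕ => (⌊r * N⌋₊ : ℝ) / Fintype.card (Σ q, Fin ⌈w q * (N + 1 : ℝ)⌉₊))
      atTop (𝓝 r) := by
  have h1 : Tendsto (fun N : ℕ => (⌊r * N⌋₊ : ℝ) / N) atTop (𝓝 r) :=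
    (tendsto_nat_floor_mul_div_atTop hr).comp tendsto_natCast_atTop_atTop
  have h2 : Tendsto (fun N : ℕ => (N : ℝ) / (N + 1)) atTop (𝓝 1) :=
    tendsto_natCast_div_add_atTop 1
  have h3 : Tendsto (fun N : ℕ =>
      (Fintype.card (Σ q, Fin ⌈w q * (N + 1 : ℝ)⌉₊) : ℝ) / (N + 1)) atTop (𝓝 1) := by
    have hN : Tendsto (fun N : ℕ => (N : ℝ) + 1) atTop atTop :=
      tendsto_atTop_add_const_right _ 1 tendsto_natCast_atTop_atTop
    have h := tendsto_finsetSum Finset.univ fun q _ =>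
      (tendsto_nat_ceil_mul_div_atTop (hw q)).comp hN
    rw [hw1] at h
    refine h.congr fun N => ?_
    simp only [Fintype.card_sigma, Fintype.card_fin, Nat.cast_sum, Finset.sum_div,
      Function.comp_apply]
  have h := (h1.mul h2).mul (h3.inv₀ one_ne_zero)
  rw [mul_one, inv_one, mul_one] at h
  refine h.congr fun N => ?_
  rcases Nat.eq_zero_or_pos N with rfl | hN
  · simp
  · have hN' : (N : ℝ) ≠ 0 := by positivity
    have hN1 : (N : ℝ) + 1 ≠ 0 := by positivity
    rw [inv_div]
    field_simp

variable {n : ℕ} {X Y : Fin (n + 1) → Type*} {V : Type*} [∀ i, Fintype (X i)]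

/-- Slots are counted with `N + 1` and bits with `N`. For a positive rate this turns the weak
constraints into the strict ones that coding needs. -/
theorem sum_mul_lt_sum_expDensity {κ : Type*} [Fintype κ] {w : κ → ℝ} (hw : ∀ q, 0 ≤ w q)
    {p : κ → ∀ i, X i → ℝ} (hp : ∀ q i, p q i ∈ stdSimplex ℝ (X i)) {α β : Type*}
    {A : (∀ i, X i) → α} {B : (∀ i, X i) → β} {ρ : κ → ℝ}
    (hρ : ∀ q, ρ q ≤ expDensity (prodLaw (p q)) A B) (h0 : 0 < ∑ q, w q * ρ q) (N : ℕ) :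
    (∑ q, w q * ρ q) * N <
      ∑ s : Σ q, Fin ⌈w q * (N + 1 : ℝ)⌉₊, expDensity (prodLaw (p s.1)) A B := by
  have h1 := mul_sum_le_sum_sigma (w := w)
    (fun q => expDensity_nonneg (prodLaw_nonneg (hp q)) A B) (N + 1)
  have h2 : ∑ q, w q * ρ q ≤ ∑ q, w q * expDensity (prodLaw (p q)) A B :=
    Finset.sum_le_sum fun q _ => mul_le_mul_of_nonneg_left (hρ q) (hw q)
  have h3 : (0 : ℝ) ≤ N := Nat.cast_nonneg N
  nlinarith

/-- Time sharing between superposition codes. -/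
theorem mem_capacityRegion_of_isRateSplit (C : Channel X Y V) {g : ∀ i, X i → X i}
    (hg : ∀ x, C.y (fun i => g i (x i)) 0 = C.y x 0) {κ : Type*} [Fintype κ] {w : κ → ℝ}
    (hw : ∀ q, 0 ≤ w q) (hw1 : ∑ q, w q = 1) {p : κ → ∀ i, X i → ℝ}
    (hp : ∀ q i, p q i ∈ stdSimplex ℝ (X i)) {R rc rp : κ → Fin (n + 1) → ℝ}
    (hR : ∀ q, IsRateSplit C g (p q) (R q) (rc q) (rp q)) :
    ∑ q, w q • R q ∈ C.capacityRegion := by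
  classical
  let ac : Fin (n + 1) → ℝ := fun i => ∑ q, w q * rc q i
  let ap : Fin (n + 1) → ℝ := fun i => ∑ q, w q * rp q i
  have hac : ∀ i, 0 ≤ ac i := fun i =>
    Finset.sum_nonneg fun q _ => mul_nonneg (hw q) ((hR q).cloud_nonneg i)
  have hap : ∀ i, 0 ≤ ap i := fun i =>
    Finset.sum_nonneg fun q _ => mul_nonneg (hw q) ((hR q).satellite_nonneg i)
  have hfl : ∀ {r : ℝ}, 0 ≤ r → ∀ N : ℕ, (⌊r * N⌋₊ : ℝ) ≤ r * N := fun hr N =>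
    Nat.floor_le (mul_nonneg hr (Nat.cast_nonneg N))
  have hpos : ∀ {r : ℝ}, 0 ≤ r → ∀ {N : ℕ}, 0 < ⌊r * N⌋₊ → 0 < r := by
    intro r hr N h
    refine hr.lt_of_ne ?_
    rintro rfl
    simp at h
  -- Achievability asks for one exact rate along the whole sequence of codes, so the bits per pass
  -- through the slots are rounded down to integers.
  have hach : ∀ N : ℕ, C.Achievable fun i => ((⌊ac i * N⌋₊ : ℕ) + (⌊ap i * N⌋₊ : ℕ) : ℝ) /
      Fintype.card (Σ q, Fin ⌈w q * (N + 1 : ℝ)⌉₊) := by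
    intro N
    have hne : Nonempty (Σ q, Fin ⌈w q * (N + 1 : ℝ)⌉₊) := by
      obtain ⟨q, -, hq⟩ := Finset.exists_ne_zero_of_sum_ne_zero (hw1.trans_ne one_ne_zero)
      have : 0 < w q := (hw q).lt_of_ne' hq
      exact ⟨⟨q, ⟨0, Nat.ceil_pos.2 (by positivity)⟩⟩⟩
    refine C.achievable_of_lt hg (p := fun s : Σ q, Fin ⌈w q * (N + 1 : ℝ)⌉₊ => p s.1)
      (fun s => hp s.1) (a := fun i => ⌊ac i * N⌋₊) (b := fun i => ⌊ap i * N⌋₊) ?_ ?_ ?_ ?_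
    · simp [ap, (hR _).satellite_zero]
    · intro h0 D hD
      have hsum : ∑ i ∈ D, ac i = ∑ q, w q * ∑ i ∈ D, rc q i := by
        simp only [ac, Finset.mul_sum]
        exact Finset.sum_comm
      have hDpos : 0 < ∑ i ∈ D, ac i :=
        (hpos (N := N) (hac 0) h0).trans_le (Finset.single_le_sum (f := ac) (fun i _ => hac i) hD)
      rw [hsum] at hDpos
      refine lt_of_le_of_lt ?_ (sum_mul_lt_sum_expDensity hw hp (fun q => (hR q).sum_le D hD) hDpos N)
      rw [← hsum, Finset.sum_mul]
      exact Finset.sum_le_sum fun i _ => hfl (hac i) N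
    · intro i h0
      have hsum : ac i.succ + ap i.succ = ∑ q, w q * (rc q i.succ + rp q i.succ) := by
        simp only [ac, ap, mul_add, Finset.sum_add_distrib]
      have h1 : 0 < ac i.succ + ap i.succ := add_pos_of_pos_of_nonneg (hpos (N := N) (hac i.succ) h0) (hap _)
      rw [hsum] at h1
      refine lt_of_le_of_lt ?_ (sum_mul_lt_sum_expDensity hw hp (fun q => (hR q).rate_le i) h1 N)
      rw [← hsum, add_mul]
      exact add_le_add (hfl (hac _) N) (hfl (hap _) N)
    · intro i h0
      exact lt_of_le_of_lt (hfl (hap _) N)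
        (sum_mul_lt_sum_expDensity hw hp (fun q => (hR q).satellite_le i) (hpos (N := N) (hap i.succ) h0) N)
  refine mem_closure_of_tendsto (b := atTop) (tendsto_pi_nhds.2 fun i => ?_)
    (Eventually.of_forall hach)
  have hlim : (∑ q, w q • R q) i = ac i + ap i := by
    simp only [Finset.sum_apply, Pi.smul_apply, smul_eq_mul, ← (hR _).add_eq i, mul_add,
      Finset.sum_add_distrib, ac, ap]
  rw [hlim]
  simp only [add_div]
  exact (tendsto_floor_div_card_slots hw hw1 (hac i)).add
    (tendsto_floor_div_card_slots hw hw1 (hap i))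

end TimeSharing

end ManyToOne

theorem theorem2 {n : ℕ} {X Y : Fin (n + 1) → Type*} {V : Type*} {U : Fin n → Type*}
    [∀ i, Fintype (X i)] [∀ i, Fintype (Y i)] [Fintype V] [∀ i, Fintype (U i)]
    (C : ManyToOne.Channel X Y V)
    (g : ∀ i : Fin n, X i.succ → U i)
    (hV : ∃ h : (∀ i, U i) → V, ∀ x : ∀ i : Fin n, X i.succ,
      C.interf x = h fun i => g i (x i)) :
    convexHull ℝ (⋃ p ∈ {p : ∀ i, X i → ℝ | ∀ i, p i ∈ stdSimplex ℝ (X i)}, C.rateRegion g p) ⊆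
      C.capacityRegion := by
  intro R hR
  obtain ⟨κ, _, w, z, hw, hw1, hz, rfl⟩ := mem_convexHull_iff_exists_fintype.1 hR
  simp only [Set.mem_iUnion, Set.mem_ofPred_eq, exists_prop] at hz
  choose p hp hz using hz
  choose r hr hr' using fun i => ManyToOne.exists_fiber_representative (g i)
  obtain ⟨h, hh⟩ := hV
  -- Representatives make cloud centers genuine input letters. For the first user the identity makes
  -- the center the codeword itself.
  let g' : ∀ i, X i → X i := Fin.cons id r
  have hg' : ∀ x, C.y (fun i => g' i (x i)) 0 = C.y x 0 := by
    intro x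
    have hv : C.v (fun i => g' i (x i)) = C.v x := by
      simp only [ManyToOne.Channel.v, hh, g', Fin.cons_succ, hr]
    simp only [ManyToOne.Channel.y, Fin.cons_zero, hv, g', id]
  choose rc rp hsplit using fun q =>
    ManyToOne.exists_isRateSplit C (g' := g') hr' (hp q) (hz q)
  exact ManyToOne.mem_capacityRegion_of_isRateSplit C hg' hw hw1 hp hsplit
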